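/- Notation. $\mathrm{Ball}(\ell^\infty)=\{z\in\mathbb C^{\mathbb N}:\sup_j|z_j|<1\}$, $\mathrm{Ball}(c_{00})$ is the set of finitely supported $z\in\mathrm{Ball}(\ell^\infty)$, and $\mathbb D^N$ is identified with the set of $z\in \mathrm{Ball}(c_{00})$ with $z_j=0$ for $j>N$. The Agler class $\mathcal A_N$ consists of the analytic $g:\mathbb D^N\to\overline{\mathbb D}$ such that $\|g(T)\|\le 1$ for every $N$-tuple $T$ of commuting operators $T_1,\dots,T_N$ on a Hilbert space with $\|T_j\|<1$ for all $j$, where $g(T)$ is defined by the absolutely convergent power series of $g$. The class $\mathcal A_\infty$ consists of the functions $f:\mathrm{Ball}(c_{00})\to\mathbb C$ whose restriction to $\mathbb D^N$ belongs to $\mathcal A_N$ for every $N$. For such $f$ put $f_N(z)=f(z_1,\dots,z_N,0,0,\dots)$. For Hilbert spaces $\mathcal H_1,\mathcal H_2,\dots$ and a contraction $V=\begin{pmatrix}A&B\\C&D\end{pmatrix}$ on $\mathbb C\oplus\bigoplus_{j}\mathcal H_j$, the transfer function of $V$ at $z\in\mathrm{Ball}(\ell^\infty)$ is $$A+B\Delta(z)(1-D\Delta(z))^{-1}C,\qquad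 \Delta(z)=\sum_{j=1}^\infty z_jP_j ,$$ where $P_j$ is the projection onto $\mathcal H_j$ within $\bigoplus_k\mathcal H_k$ and the sum converges in the strong operator topology. A function $g$ on $X\subseteq\mathrm{Ball}(\ell^\infty)$ has a contractive transfer function realization if it agrees on $X$ with the transfer function of some such $V$; it has an absolutely convergent Agler decomposition if there are positive semi-definite functions $K_1,K_2,\dots$ on $X\times X$ with $$1-g(z)\overline{g(w)}=\sum_{j=1}^\infty(1-z_j\bar w_j)K_j(z,w)\qquad(z,w\in X),$$ the sum converging absolutely. **Theorem 1.2.** (a) Let $f\in\mathcal A_\infty$. Then there are Hilbert spaces $\mathcal H_1,\mathcal H_2,\dots$ and a contraction $V=\begin{pmatrix}A&B\\C&D\end{pmatrix}$ on $\mathbb C\oplus\bigoplus_j\mathcal H_j$ such that the following hold. 1. For every $z\in\mathrm{Ball}(\ell^\infty)$ the operator $1-D\Delta(z)$ is invertible, and the transfer function $$F(z)=A+B\Delta(z)(1-D\Delta(z))^{-1}C$$ equals $f(z)$ for $z\in\mathrm{Ball}(c_{00})$. Thus $F$ extends $f$ to $\mathrm{Ball}(\ell^\infty)$. The extension $F$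 is holomorphic (Fréchet differentiable), satisfies $|F|\le1$, and $\lim_{N\to\infty}f_N(z)=F(z)$ for every $z\in\mathrm{Ball}(\ell^\infty)$. 2. $F$ has an absolutely convergent Agler decomposition on $\mathrm{Ball}(\ell^\infty)$. 3. Let $T=(T_1,T_2,\dots)$ be a tuple of commuting operators on a Hilbert space $\mathcal E$ with $\sup_j\|T_j\|<1$. Then $\Delta(T)=\sum_{j=1}^\infty P_j\otimes T_j$ converges in the strong operator topology on $(\bigoplus_j\mathcal H_j)\otimes\mathcal E$, the operator $1-(D\otimes I)\Delta(T)$ is invertible, and, with $$f(T):=(A\otimes I)+(B\otimes I)\Delta(T)(1-(D\otimes I)\Delta(T))^{-1}(C\otimes I)$$ (an operator on $\mathbb C\otimes\mathcal E\cong\mathcal E$), the operators $f_N(T)$, given by the absolutely convergent power series of $f_N$ at $(T_1,\dots,T_N)$, converge to $f(T)$ in the strong operator topology as $N\to\infty$. Moreover $\|f(T)\|\le1$ (von Neumann's inequality). (b) Let $X\subseteq\mathrm{Ball}(\ell^\infty)$ and $g:X\to\mathbb C$. Then $g$ has a contractive transfer function realization on $X$ if and only if it has an absolutely convergent Agler decomposition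 on $X$. -/

import Mathlib

universe u

open Filter Topology
open scoped TensorProduct ENNReal ComplexConjugate

noncomputable section

namespace SchurAgler

/-! ### Polydisks and unit balls of sequence spaces

Sequences are functions `ℕ → ℂ`; the index `j : ℕ` stands for the `(j+1)`-st variable. -/

/-- The open unit polydisk in `N` variables. -/
def polydisk (N : ℕ) : Set (Fin N → ℂ) := {z | ∀ j, ‖z j‖ < 1}

/-- The open unit ball of `ℓ^∞`: sequences with `sup_j |z_j| < 1`. -/
def ballLinfty : Set (ℕ → ℂ) := {z | ∃ r : ℝ, r < 1 ∧ ∀ j, ‖z j‖ ≤ r}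

/-- The open unit ball of `c_00`: sequences in the open unit ball of `ℓ^∞` that vanish from some
index on. -/
def ballC00 : Set (ℕ → ℂ) := {z | z ∈ ballLinfty ∧ ∃ N : ℕ, ∀ j, N ≤ j → z j = 0}

/-- The inclusion `(z_1, …, z_N) ↦ (z_1, …, z_N, 0, 0, …)`. -/
def extendByZero {N : ℕ} (z : Fin N → ℂ) : ℕ → ℂ := fun j => if h : j < N then z ⟨j, h⟩ else 0

/-- The truncation `z ↦ (z_1, …, z_N, 0, 0, …)`. -/
def truncate (N : ℕ) (z : ℕ → ℂ) : ℕ → ℂ := fun j => if j < N then z j else 0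

/-- The function of `N` variables `(z_1, …, z_N) ↦ f (z_1, …, z_N, 0, 0, …)`. -/
def restrictVars (f : (ℕ → ℂ) → ℂ) (N : ℕ) : (Fin N → ℂ) → ℂ := fun z => f (extendByZero z)

/-! ### The Schur and Agler classes -/

/-- The Schur class in `N` variables: analytic functions from the polydisk to the closed disk. -/
def SchurClass (N : ℕ) (g : (Fin N → ℂ) → ℂ) : Prop :=
  AnalyticOnNhd ℂ g (polydisk N) ∧ ∀ z ∈ polydisk N, ‖g z‖ ≤ 1

/-- `c` is the family of coefficients of a power series with sum `g` on the polydisk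
(`HasSum` in `ℂ` is absolute convergence). -/
def IsPowerSeriesOf {N : ℕ} (c : (Fin N → ℕ) → ℂ) (g : (Fin N → ℂ) → ℂ) : Prop :=
  ∀ z ∈ polydisk N, HasSum (fun α : Fin N → ℕ => c α * ∏ j, z j ^ α j) (g z)

section Operators

variable {E : Type*} [NormedAddCommGroup E] [InnerProductSpace ℂ E]

/-- The operator monomial `T_1 ^ α_1 ⋯ T_N ^ α_N`. -/
def opMonomial {N : ℕ} (T : Fin N → E →L[ℂ] E) (α : Fin N → ℕ) : E →L[ℂ] E :=
  (List.ofFn fun j => T j ^ α j).prod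

/-- `S = g(T)`, where `g(T)` is defined by the absolutely (that is, norm-) convergent power series
of `g`. The coefficients `c` are uniquely determined by `g`, hence `S` by `g` and `T`. -/
def IsPowerSeriesCalc {N : ℕ} (g : (Fin N → ℂ) → ℂ) (T : Fin N → E →L[ℂ] E)
    (S : E →L[ℂ] E) : Prop :=
  ∃ c : (Fin N → ℕ) → ℂ, IsPowerSeriesOf c g ∧
    Summable (fun α => ‖c α • opMonomial T α‖) ∧ HasSum (fun α => c α • opMonomial T α) S

end Operators

/-- The Agler class in `N` variables: Schur class functions `g` with `‖g(T)‖ ≤ 1` for all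
`N`-tuples of commuting strict contractions on a Hilbert space. Hilbert spaces in the lowest
universe suffice here (they include all separable ones up to isometry). -/
def AglerClass (N : ℕ) (g : (Fin N → ℂ) → ℂ) : Prop :=
  SchurClass N g ∧
    ∀ (E : Type) [NormedAddCommGroup E] [InnerProductSpace ℂ E] [CompleteSpace E]
      (T : Fin N → E →L[ℂ] E), (∀ i j, Commute (T i) (T j)) → (∀ j, ‖T j‖ < 1) →
      ∀ S : E →L[ℂ] E, IsPowerSeriesCalc g T S → ‖S‖ ≤ 1

/-- The Agler class in infinitely many variables. Only the values of `f` on the open unit ball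
of `c_00` matter. -/
def AglerClassInfty (f : (ℕ → ℂ) → ℂ) : Prop := ∀ N : ℕ, AglerClass N (restrictVars f N)

/-! ### Transfer functions -/

section Transfer

variable (H : ℕ → Type*) [∀ j, NormedAddCommGroup (H j)] [∀ j, InnerProductSpace ℂ (H j)]

/-- The Hilbert space direct sum `⨁ H_j`. -/
abbrev HilbertSum : Type _ := lp H 2

/-- The Hilbert space `ℂ ⊕ ⨁ H_j`. -/
abbrev StateSpace : Type _ := WithLp 2 (ℂ × HilbertSum H)

/-- The projection `P_j` onto `H_j` within `⨁ H_j`. -/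
def proj (j : ℕ) : HilbertSum H →L[ℂ] HilbertSum H :=
  (lp.singleContinuousLinearMap ℂ H 2 j) ∘L (lp.evalCLM ℂ H 2 j)

variable {H}

/-- The inclusion of `⨁ H_j` in `ℂ ⊕ ⨁ H_j`. -/
def inclSum : HilbertSum H →L[ℂ] StateSpace H :=
  (WithLp.prodContinuousLinearEquiv 2 ℂ ℂ (HilbertSum H)).symm.toContinuousLinearMap ∘L
    ContinuousLinearMap.inr ℂ ℂ (HilbertSum H)

/-- The inclusion of `ℂ` in `ℂ ⊕ ⨁ H_j`. -/
def inclScalar : ℂ →L[ℂ] StateSpace H :=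
  (WithLp.prodContinuousLinearEquiv 2 ℂ ℂ (HilbertSum H)).symm.toContinuousLinearMap ∘L
    ContinuousLinearMap.inl ℂ ℂ (HilbertSum H)

/-- The block `A : ℂ → ℂ` of `V = (A B; C D)`. -/
def blockA (V : StateSpace H →L[ℂ] StateSpace H) : ℂ →L[ℂ] ℂ :=
  WithLp.fstL 2 ℂ ℂ (HilbertSum H) ∘L V ∘L inclScalar

/-- The block `B : ⨁ H_j → ℂ` of `V = (A B; C D)`. -/
def blockB (V : StateSpace H →L[ℂ] StateSpace H) : HilbertSum H →L[ℂ] ℂ :=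
  WithLp.fstL 2 ℂ ℂ (HilbertSum H) ∘L V ∘L inclSum

/-- The block `C : ℂ → ⨁ H_j` of `V = (A B; C D)`. -/
def blockC (V : StateSpace H →L[ℂ] StateSpace H) : ℂ →L[ℂ] HilbertSum H :=
  WithLp.sndL 2 ℂ ℂ (HilbertSum H) ∘L V ∘L inclScalar

/-- The block `D : ⨁ H_j → ⨁ H_j` of `V = (A B; C D)`. -/
def blockD (V : StateSpace H →L[ℂ] StateSpace H) : HilbertSum H →L[ℂ] HilbertSum H :=
  WithLp.sndL 2 ℂ ℂ (HilbertSum H) ∘L V ∘L inclSum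

/-- The series of operators `∑ A_j` converges to `S` in the strong operator topology. -/
def IsStrongSum {E : Type*} [NormedAddCommGroup E] [InnerProductSpace ℂ E]
    (A : ℕ → E →L[ℂ] E) (S : E →L[ℂ] E) : Prop :=
  ∀ x : E, HasSum (fun j => A j x) (S x)

/-- `w = A + B Δ(z) (1 - D Δ(z))⁻¹ C`, where `Δ(z) = ∑ z_j P_j` converges strongly and
`1 - D Δ(z)` is invertible. -/
def IsTransferValue (V : StateSpace H →L[ℂ] StateSpace H) (z : ℕ → ℂ) (w : ℂ) : Prop :=
  ∃ Δ : HilbertSum H →L[ℂ] HilbertSum H, IsStrongSum (fun j => z j • proj H j) Δ ∧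
    IsUnit (1 - blockD V ∘L Δ) ∧
    w = (blockA V + blockB V ∘L Δ ∘L Ring.inverse (1 - blockD V ∘L Δ) ∘L blockC V) 1

/-! ### Transfer functions of operator tuples -/

/-- The Hilbert space tensor product: the completion of the algebraic tensor product with
`⟪a ⊗ x, b ⊗ y⟫ = ⟪a, b⟫ ⟪x, y⟫`. -/
abbrev HilbertTensor (K E : Type*) [NormedAddCommGroup K] [InnerProductSpace ℂ K]
    [NormedAddCommGroup E] [InnerProductSpace ℂ E] : Type _ :=
  UniformSpace.Completion (K ⊗[ℂ] E)

variable {E : Type*} [NormedAddCommGroup E] [InnerProductSpace ℂ E]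

/-- The bounded operator `S ⊗ T` on the Hilbert space tensor product. -/
def tensorOp {K L : Type*} [NormedAddCommGroup K] [InnerProductSpace ℂ K]
    [NormedAddCommGroup L] [InnerProductSpace ℂ L]
    (S : K →L[ℂ] L) (T : E →L[ℂ] E) : HilbertTensor K E →L[ℂ] HilbertTensor L E :=
  (TensorProduct.mapL S T).completion

/-- The identification `E → ℂ ⊗ E`, `x ↦ 1 ⊗ x`. -/
def toScalarTensor : E →L[ℂ] HilbertTensor ℂ E :=
  UniformSpace.Completion.toComplL ∘L
    (TensorProduct.lidIsometry ℂ E).symm.toContinuousLinearEquiv.toContinuousLinearMap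

/-- The identification `ℂ ⊗ E → E`, `a ⊗ x ↦ a x`. -/
def ofScalarTensor [CompleteSpace E] : HilbertTensor ℂ E →L[ℂ] E :=
  ((TensorProduct.lidIsometry ℂ E).toContinuousLinearEquiv.toContinuousLinearMap).fromCompletion

/-- `S = (A ⊗ I) + (B ⊗ I) Δ(T) (1 - (D ⊗ I) Δ(T))⁻¹ (C ⊗ I)`, where `Δ(T) = ∑ P_j ⊗ T_j` converges
strongly, `1 - (D ⊗ I) Δ(T)` is invertible, and `ℂ ⊗ E` is identified with `E`. -/
def IsTransferOperator [CompleteSpace E] (V : StateSpace H →L[ℂ] StateSpace H)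
    (T : ℕ → E →L[ℂ] E) (S : E →L[ℂ] E) : Prop :=
  ∃ Δ : HilbertTensor (HilbertSum H) E →L[ℂ] HilbertTensor (HilbertSum H) E,
    IsStrongSum (fun j => tensorOp (proj H j) (T j)) Δ ∧
    IsUnit (1 - tensorOp (blockD V) 1 ∘L Δ) ∧
    S = ofScalarTensor ∘L
      (tensorOp (blockA V) 1 + tensorOp (blockB V) 1 ∘L Δ ∘L
        Ring.inverse (1 - tensorOp (blockD V) 1 ∘L Δ) ∘L tensorOp (blockC V) 1) ∘L
      toScalarTensor

end Transfer

/-- `g` has on `X` a contractive transfer function realization. -/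
def HasTransferRealization (X : Set (ℕ → ℂ)) (g : (ℕ → ℂ) → ℂ) : Prop :=
  ∃ (H : ℕ → Type) (_ : ∀ j, NormedAddCommGroup (H j)) (_ : ∀ j, InnerProductSpace ℂ (H j))
    (_ : ∀ j, CompleteSpace (H j)) (V : StateSpace H →L[ℂ] StateSpace H),
    ‖V‖ ≤ 1 ∧ ∀ z ∈ X, IsTransferValue V z (g z)

/-! ### Agler decompositions -/

/-- `K` is a positive semi-definite function on `X × X`. -/
def PosSemidefOn (X : Set (ℕ → ℂ)) (K : (ℕ → ℂ) → (ℕ → ℂ) → ℂ) : Prop :=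
  ∀ Y : Finset (ℕ → ℂ), (∀ z ∈ Y, z ∈ X) → ∀ a : (ℕ → ℂ) → ℂ,
    0 ≤ (∑ z ∈ Y, ∑ w ∈ Y, a z * conj (a w) * K z w).re ∧
    (∑ z ∈ Y, ∑ w ∈ Y, a z * conj (a w) * K z w).im = 0

/-- `g` has on `X` an absolutely convergent Agler decomposition
`1 - g(z) conj(g(w)) = ∑ (1 - z_j conj(w_j)) K_j(z,w)` with positive semi-definite `K_j`. -/
def HasAglerDecomposition (X : Set (ℕ → ℂ)) (g : (ℕ → ℂ) → ℂ) : Prop :=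
  ∃ K : ℕ → (ℕ → ℂ) → (ℕ → ℂ) → ℂ, (∀ j, PosSemidefOn X (K j)) ∧
    ∀ z ∈ X, ∀ w ∈ X,
      Summable (fun j => ‖(1 - z j * conj (w j)) * K j z w‖) ∧
      HasSum (fun j => (1 - z j * conj (w j)) * K j z w) (1 - g z * conj (g w))

end SchurAgler

end

/-!
A function `f` of the Agler class in infinitely many variables is first given an Agler
decomposition on the unit ball of `c_00`; everything else is read off a contraction `V` that
realizes it.

**Decomposition.** On a finite set `Y` of points of the ball of `c_00` only finitely many variables
matter, and `1 - f(z) conj f(w)` lies in the closure of the convex cone of the kernels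
`∑ (1 - z_j conj w_j) K_j` on `Y`. Otherwise a real functional separates it from the cone. This
functional defines a Hermitian form in which multiplication by each coordinate is a contraction,
strict after a small perturbation; multiplication by the coordinates is then a tuple of commuting
strict contractions with the points of `Y` as joint eigenvalues, at which von Neumann's inequality
for `f` contradicts the separation (`AglerClassInfty.exists_approx_decomposition`). The power series
of `f` needed to speak of `f(T)` comes from `SchurClass.exists_isPowerSeriesOf`. As `Y` exhausts the
ball, the kernels are bounded on the diagonal and have limits along an ultrafilter. Part of their
mass may escape to infinitely large indices `j`; since each point has `z_j = 0` for large `j`, what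
escapes is a positive semi-definite remainder, and dividing it by `1 - z_0 conj w_0` it is absorbed
in the first kernel (`AglerClassInfty.hasAglerDecomposition`).

**Realization.** With `K_j(z,w) = ⟪u_j(w), u_j(z)⟫`, a decomposition says exactly that the vectors
`(1, Δ(z) u(z))` and `(g(z), u(z))` of `ℂ ⊕ ⨁ H_j` have the same Gram matrix, so that a contraction
`V` maps the one family to the other; solving `V (1, Δ(z) u(z)) = (g(z), u(z))` for `g(z)` gives the
transfer function. Conversely the defect of a contraction is positive semi-definite and is absorbed
as before. This proves the equivalence on arbitrary subsets of the ball of `ℓ^∞`.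

**Extension and functional calculus.** As `‖D‖ ≤ 1` and `‖Δ(z)‖ < 1`, the transfer function of `V`
makes sense on the whole ball of `ℓ^∞`, and strong convergence of the partial sums of `Δ` passes to
the resolvents (`tendsto_transferOp_apply`). For operator tuples the same applies to
`Δ(T) = ∑ P_j ⊗ T_j` and the amplification `V ⊗ I`. What links this to the functions `f_N(T)` is
that the Taylor coefficients of the transfer function can be computed in terms of `V` and are the
same whether the variables are numbers or commuting operators (`exists_state_vector`).
-/

noncomputable section

namespace SchurAgler

/-! ### Operator monomials and absolutely convergent power series -/

section Monomials

variable {E : Type*} [NormedAddCommGroup E] [InnerProductSpace ℂ E]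

lemma opMonomial_succ {N : ℕ} (T : Fin (N + 1) → E →L[ℂ] E) (α : Fin (N + 1) → ℕ) :
    opMonomial T α =
      T 0 ^ α 0 * opMonomial (fun j => T j.succ) (fun j => α j.succ) := by
  simp [opMonomial, List.ofFn_succ]

lemma norm_opMonomial_le {N : ℕ} (T : Fin N → E →L[ℂ] E) (α : Fin N → ℕ) :
    ‖opMonomial T α‖ ≤ ∏ j, ‖T j‖ ^ α j := by
  induction N with
  | zero => simpa [opMonomial, ContinuousLinearMap.one_def] using
      ContinuousLinearMap.norm_id_le (𝕜 := ℂ) (E := E)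
  | succ N ih =>
    rw [opMonomial_succ, Fin.prod_univ_succ]
    refine (norm_mul_le _ _).trans (mul_le_mul ?_ (ih _ _) (norm_nonneg _) (by positivity))
    rcases Nat.eq_zero_or_pos (α 0) with h | h
    · simpa [h, ContinuousLinearMap.one_def] using
        ContinuousLinearMap.norm_id_le (𝕜 := ℂ) (E := E)
    · exact norm_pow_le' _ h

lemma mul_opMonomial {N : ℕ} {T : Fin N → E →L[ℂ] E} (hT : ∀ i j, Commute (T i) (T j))
    (j : Fin N) (α : Fin N → ℕ) :
    T j * opMonomial T α = opMonomial T (α + Pi.single j 1) := by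
  induction N with
  | zero => exact j.elim0
  | succ N ih =>
    rw [opMonomial_succ, opMonomial_succ]
    refine Fin.cases ?_ (fun i => ?_) j
    · have : (fun i : Fin N => (α + Pi.single 0 1 : Fin (N + 1) → ℕ) i.succ) =
          fun i => α i.succ := by
        ext i; simp
      rw [this, ← mul_assoc, ← pow_succ']
      simp
    · have : (fun k : Fin N => (α + Pi.single i.succ 1 : Fin (N + 1) → ℕ) k.succ) =
          (fun k : Fin N => α k.succ) + Pi.single i 1 := by
        ext k; simp [Pi.single_apply]
      rw [this, ← ih (fun a b => hT _ _), ← mul_assoc, ← mul_assoc,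
        ((hT i.succ 0).pow_right _).eq]
      simp

lemma opMonomial_zero {N : ℕ} (T : Fin N → E →L[ℂ] E) : opMonomial T 0 = 1 := by
  induction N with
  | zero => simp [opMonomial]
  | succ N ih =>
    rw [opMonomial_succ]
    simpa [Pi.zero_def] using ih _

lemma opMonomial_apply_of_eigenvector {N : ℕ} {T : Fin N → E →L[ℂ] E} {ζ : Fin N → ℂ} {v : E}
    (h : ∀ j, T j v = ζ j • v) (α : Fin N → ℕ) :
    opMonomial T α v = (∏ j, ζ j ^ α j) • v := by
  induction N with
  | zero => simp [opMonomial]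
  | succ N ih =>
    have key : ∀ n : ℕ, (T 0 ^ n) v = ζ 0 ^ n • v := by
      intro n
      induction n with
      | zero => simp
      | succ n ihn => rw [pow_succ, mul_apply_eq_comp, h 0, map_smul, ihn, smul_smul,
          pow_succ']
    rw [opMonomial_succ, mul_apply_eq_comp, ih (fun j => h j.succ), map_smul, key,
      smul_smul, Fin.prod_univ_succ, mul_comm]

lemma IsPowerSeriesOf.summable_norm_smul_opMonomial {N : ℕ} {c : (Fin N → ℕ) → ℂ}
    {g : (Fin N → ℂ) → ℂ} (hc : IsPowerSeriesOf c g) {T : Fin N → E →L[ℂ] E}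
    (hT : ∀ j, ‖T j‖ < 1) : Summable fun α => ‖c α • opMonomial T α‖ := by
  have h := (hc (fun j => (‖T j‖ : ℂ)) (fun j => by simpa using hT j)).summable.norm
  refine Summable.of_nonneg_of_le (fun _ => norm_nonneg _) (fun α => ?_) h
  rw [norm_smul, norm_mul]
  refine mul_le_mul_of_nonneg_left ((norm_opMonomial_le T α).trans_eq ?_) (norm_nonneg _)
  simp [norm_prod]

/-- A power series of operators acts on a joint eigenvector as multiplication by the value of the
power series at the joint eigenvalue. -/
lemma apply_eigenvector_of_hasSum {N : ℕ} {c : (Fin N → ℕ) → ℂ} {g : (Fin N → ℂ) → ℂ}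
    (hc : IsPowerSeriesOf c g) {T : Fin N → E →L[ℂ] E} {S : E →L[ℂ] E}
    (hS : HasSum (fun α => c α • opMonomial T α) S) {ζ : Fin N → ℂ} (hζ : ζ ∈ polydisk N) {v : E}
    (h : ∀ j, T j v = ζ j • v) : S v = g ζ • v := by
  have h1 := hS.mapL (ContinuousLinearMap.apply ℂ E v)
  have h2 := (hc ζ hζ).smul_const v
  refine h1.unique ?_
  convert h2 using 2 with α
  simp [opMonomial_apply_of_eigenvector h, smul_smul]

end Monomials

lemma summable_prod_pow {N : ℕ} {r : Fin N → ℝ} (h0 : ∀ j, 0 ≤ r j) (h1 : ∀ j, r j < 1) :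
    Summable fun α : Fin N → ℕ => ∏ j, r j ^ α j := by
  induction N with
  | zero => exact Summable.of_finite
  | succ N ih =>
    rw [← (Fin.consEquiv fun _ : Fin (N + 1) => ℕ).summable_iff]
    have := (summable_geometric_of_lt_one (h0 0) (h1 0)).mul_of_nonneg
      (ih (fun j => h0 j.succ) (fun j => h1 j.succ)) (fun _ => pow_nonneg (h0 0) _)
      (fun _ => Finset.prod_nonneg fun j _ => pow_nonneg (h0 _) _)
    refine this.congr fun x => ?_
    simp [Fin.prod_univ_succ, Fin.consEquiv]

/-! ### Power series of bounded analytic functions on the polydisk -/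

section Taylor

/-- The exponent of the monomial `∏ i, z (r i)`: how often each index is a value of `r`. -/
def multiplicity {n N : ℕ} (r : Fin n → Fin N) : Fin N → ℕ :=
  fun j => (Finset.univ.filter fun i => r i = j).card

lemma prod_eq_prod_pow_multiplicity {n N : ℕ} (r : Fin n → Fin N) (z : Fin N → ℂ) :
    ∏ i, z (r i) = ∏ j, z j ^ multiplicity r j := by
  rw [← Finset.prod_fiberwise' Finset.univ r z]
  simp [multiplicity]

lemma sum_multiplicity {n N : ℕ} (r : Fin n → Fin N) : ∑ j, multiplicity r j = n := by
  have := Finset.card_eq_sum_card_fiberwise (f := r) (s := Finset.univ) (t := Finset.univ)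
    (fun _ _ => Finset.mem_coe.2 (Finset.mem_univ _))
  simpa [multiplicity] using this.symm

/-- The coefficient of `z ^ α` in the polynomial `z ↦ q (z, …, z)`. -/
def diagCoeff {n N : ℕ} (q : ContinuousMultilinearMap ℂ (fun _ : Fin n => Fin N → ℂ) ℂ)
    (α : Fin N → ℕ) : ℂ :=
  ∑ r : Fin n → Fin N with multiplicity r = α, q fun i => Pi.single (r i) 1

lemma apply_diag_eq_sum {n N : ℕ}
    (q : ContinuousMultilinearMap ℂ (fun _ : Fin n => Fin N → ℂ) ℂ) (z : Fin N → ℂ) :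
    q (fun _ => z) = ∑ α ∈ Finset.univ.image (multiplicity : (Fin n → Fin N) → Fin N → ℕ),
      diagCoeff q α * ∏ j, z j ^ α j := by
  have hz : z = ∑ j, z j • (Pi.single j 1 : Fin N → ℂ) := by
    ext k; simp [Finset.sum_apply, Pi.single_apply]
  have h1 : q (fun _ => z) = ∑ r : Fin n → Fin N,
      (∏ i, z (r i)) * q fun i => Pi.single (r i) 1 := by
    conv_lhs => rw [hz]
    rw [q.map_sum]
    refine Finset.sum_congr rfl fun r _ => ?_
    rw [q.map_smul_univ, smul_eq_mul]
  rw [h1, ← Finset.sum_fiberwise_of_maps_to (t := Finset.univ.image multiplicity)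
    (fun r _ => Finset.mem_image_of_mem multiplicity (Finset.mem_univ r))]
  refine Finset.sum_congr rfl fun α _ => ?_
  rw [diagCoeff, Finset.sum_mul]
  refine Finset.sum_congr rfl fun r hr => ?_
  rw [prod_eq_prod_pow_multiplicity, (Finset.mem_filter.1 hr).2, mul_comm]

open UnitAddTorus in
/-- Cauchy's estimate for the coefficients of a polynomial in several variables. -/
lemma norm_coeff_le_of_forall_torus {N : ℕ} (s : Finset (Fin N → ℕ)) (c : (Fin N → ℕ) → ℂ)
    (h : ∀ z : Fin N → ℂ, (∀ j, ‖z j‖ = 1) → ‖∑ α ∈ s, c α * ∏ j, z j ^ α j‖ ≤ 1)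
    {β : Fin N → ℕ} (hβ : β ∈ s) : ‖c β‖ ≤ 1 := by
  let ι : (Fin N → ℕ) → (Fin N → ℤ) := fun α j => α j
  have hι : Function.Injective ι := fun a b hab => by
    ext j; simpa [ι] using congrFun hab j
  let P : C(UnitAddTorus (Fin N), ℂ) := ∑ α ∈ s, c α • mFourier (ι α)
  have hP : ‖P‖ ≤ 1 := by
    rw [ContinuousMap.norm_le _ zero_le_one]
    intro x
    have hx := h (fun j => fourier 1 (x j)) fun j => by
      rw [fourier_apply]; exact Circle.norm_coe _
    have : P x = ∑ α ∈ s, c α * ∏ j, (fourier 1 (x j) : ℂ) ^ α j := by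
      simp only [P, ContinuousMap.coe_sum, Finset.sum_apply, ContinuousMap.coe_smul,
        Pi.smul_apply, smul_eq_mul]
      refine Finset.sum_congr rfl fun α _ => ?_
      congr 1
      simp only [mFourier, ContinuousMap.coe_mk, ι, fourier_apply]
      refine Finset.prod_congr rfl fun j _ => ?_
      rw [one_zsmul, natCast_zsmul, AddCircle.toCircle_nsmul, Circle.coe_pow]
    rw [this]
    exact hx
  -- the normalised Haar measure used by Mathlib for Fourier series in several variables
  let _ : MeasureTheory.MeasureSpace UnitAddCircle := ⟨AddCircle.haarAddCircle⟩
  have _ : MeasureTheory.IsProbabilityMeasure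
      (MeasureTheory.volume : MeasureTheory.Measure UnitAddCircle) :=
    inferInstanceAs (MeasureTheory.IsProbabilityMeasure AddCircle.haarAddCircle)
  have ho := (orthonormal_mFourier (d := Fin N)).comp ι hι
  have h1 := ho.inner_right_sum c hβ
  have h2 : ∑ α ∈ s, c α • (mFourierLp 2 ∘ ι) α = ContinuousMap.toLp 2
      (MeasureTheory.volume : MeasureTheory.Measure (UnitAddTorus (Fin N))) ℂ P := by
    simp [P, map_sum]
  rw [h2] at h1
  rw [← h1]
  refine (norm_inner_le_norm _ _).trans ?_
  rw [ho.1 β, one_mul]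
  refine (ContinuousLinearMap.le_opNorm _ _).trans ?_
  refine (mul_le_mul (ContinuousMap.toLp_norm_le _) hP (norm_nonneg _) (by positivity)).trans ?_
  simp [MeasureTheory.measureUnivNNReal]

/-- Every function of the Schur class is the sum of a power series on the polydisk. The series is
the Taylor series at the origin: on each slice `λ ↦ g (λ z)` the Cauchy estimate bounds its
homogeneous parts by one, hence all the coefficients are bounded by one. -/
lemma SchurClass.exists_isPowerSeriesOf {N : ℕ} {g : (Fin N → ℂ) → ℂ} (hg : SchurClass N g) :
    ∃ c : (Fin N → ℕ) → ℂ, IsPowerSeriesOf c g := by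
  obtain ⟨p, hp⟩ := hg.1 0 (fun j => by simp)
  have slice : ∀ z ∈ polydisk N,
      HasSum (fun n => p n fun _ => z) (g z) ∧ ∀ n, ‖p n fun _ => z‖ ≤ 1 := by
    intro z hz
    have hz1 : ‖z‖ < 1 := (pi_norm_lt_iff one_pos).2 hz
    let R : NNReal := ⟨2 / (1 + ‖z‖), by positivity⟩
    have hR : (R : ℝ) = 2 / (1 + ‖z‖) := rfl
    have hR1 : 1 < (R : ℝ) := by
      rw [hR, lt_div_iff₀ (by positivity)]; linarith
    have hRz : (R : ℝ) * ‖z‖ < 1 := by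
      rw [hR, div_mul_eq_mul_div, div_lt_one (by positivity)]; linarith
    let u : ℂ →L[ℂ] (Fin N → ℂ) := (ContinuousLinearMap.id ℂ ℂ).smulRight z
    have hmem : ∀ w : ℂ, ‖w‖ ≤ R → u w ∈ polydisk N := fun w hw j => by
      have : ‖w‖ * ‖z j‖ ≤ R * ‖z‖ :=
        mul_le_mul hw (norm_le_pi_norm z j) (norm_nonneg _) R.2
      simpa [u] using this.trans_lt hRz
    have h1 : HasFPowerSeriesAt (g ∘ u) (p.compContinuousLinearMap u) 0 :=
      HasFPowerSeriesAt.compContinuousLinearMap (by simpa [u] using hp)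
    have h2 : HasFPowerSeriesOnBall (g ∘ u) (cauchyPowerSeries (g ∘ u) 0 R) 0 R := by
      refine DifferentiableOn.hasFPowerSeriesOnBall (fun w hw => ?_) (by
        exact_mod_cast one_pos.trans hR1)
      have := (hg.1 (u w) (hmem w (by simpa using hw))).differentiableAt
      exact (this.comp w u.differentiableAt).differentiableWithinAt
    have h3 := h1.eq_formalMultilinearSeries h2.hasFPowerSeriesAt
    have h4 : ∀ n, (p n fun _ => z) = cauchyPowerSeries (g ∘ u) 0 R n fun _ => 1 := by
      intro n
      rw [← h3]
      simp only [FormalMultilinearSeries.compContinuousLinearMap_apply]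
      congr 1
      ext i; simp [u]
    refine ⟨?_, fun n => ?_⟩
    · have := h2.hasSum (y := 1) (by simpa using mod_cast hR1)
      simpa [← h4, u] using this
    · rw [h4]
      refine (ContinuousMultilinearMap.le_opNorm _ _).trans ?_
      simp only [norm_one, Finset.prod_const_one, mul_one]
      refine (norm_cauchyPowerSeries_le _ _ _ _).trans ?_
      have hint : (2 * Real.pi)⁻¹ * ∫ θ : ℝ in (0)..(2 * Real.pi),
          ‖(g ∘ u) (circleMap 0 R θ)‖ ≤ 1 := by
        have : ∫ θ : ℝ in (0)..(2 * Real.pi), ‖(g ∘ u) (circleMap 0 R θ)‖ ≤ 2 * Real.pi := by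
          have := intervalIntegral.norm_integral_le_of_norm_le_const (C := 1) (a := 0)
            (b := 2 * Real.pi) (f := fun θ => ‖(g ∘ u) (circleMap 0 R θ)‖) (fun θ _ => by
              rw [norm_norm]
              exact hg.2 _ (hmem _ (by simp)))
          rw [sub_zero, one_mul, abs_of_pos Real.two_pi_pos] at this
          exact (le_abs_self _).trans this
        rw [inv_mul_le_iff₀ Real.two_pi_pos, mul_one]
        exact this
      have hpow : |(R : ℝ)|⁻¹ ^ n ≤ 1 := by
        refine pow_le_one₀ (by positivity) (inv_le_one_of_one_le₀ ?_)
        exact hR1.le.trans (le_abs_self _)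
      exact mul_le_one₀ hint (by positivity) hpow
  have torus : ∀ n, ∀ z : Fin N → ℂ, (∀ j, ‖z j‖ = 1) → ‖p n fun _ => z‖ ≤ 1 := by
    intro n z hz
    have hc : Continuous fun s : ℝ => ‖p n fun _ => s • z‖ := by fun_prop
    have ht : Tendsto (fun s : ℝ => ‖p n fun _ => s • z‖) (𝓝[<] 1) (𝓝 ‖p n fun _ => z‖) := by
      have := (hc.tendsto 1).mono_left (nhdsWithin_le_nhds (s := Set.Iio 1))
      simpa using this
    refine le_of_tendsto ht ?_
    filter_upwards [Ioo_mem_nhdsLT (show (0 : ℝ) < 1 by norm_num)] with s hs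
    refine (slice _ fun j => ?_).2 n
    simpa [hz j, abs_of_pos hs.1] using hs.2
  have hcoeff : ∀ n, ∀ α ∈ Finset.univ.image (multiplicity : (Fin n → Fin N) → Fin N → ℕ),
      ‖diagCoeff (p n) α‖ ≤ 1 := by
    intro n α hα
    refine norm_coeff_le_of_forall_torus _ (diagCoeff (p n)) (fun z hz => ?_) hα
    rw [← apply_diag_eq_sum]
    exact torus n z hz
  have hzero : ∀ n, ∀ α ∉ Finset.univ.image (multiplicity : (Fin n → Fin N) → Fin N → ℕ),
      diagCoeff (p n) α = 0 := by
    intro n α hα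
    refine Finset.sum_eq_zero fun r hr => (hα ?_).elim
    exact Finset.mem_image.2 ⟨r, Finset.mem_univ _, (Finset.mem_filter.1 hr).2⟩
  refine ⟨fun α => diagCoeff (p (∑ j, α j)) α, fun z hz => ?_⟩
  have hsum : Summable fun α : Fin N → ℕ => diagCoeff (p (∑ j, α j)) α * ∏ j, z j ^ α j := by
    refine Summable.of_norm_bounded (g := fun α => ∏ j, ‖z j‖ ^ α j)
      (summable_prod_pow (fun _ => norm_nonneg _) hz) fun α => ?_
    rw [norm_mul, norm_prod]
    simp only [norm_pow]
    refine mul_le_of_le_one_left (by positivity) ?_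
    by_cases hα : α ∈ Finset.univ.image (multiplicity : (Fin (∑ j, α j) → Fin N) → Fin N → ℕ)
    · exact hcoeff _ α hα
    · simp [hzero _ α hα]
  have hs := (Equiv.sigmaFiberEquiv fun α : Fin N → ℕ => ∑ j, α j).hasSum_iff.2 hsum.hasSum
  have hfib : ∀ n, HasSum (fun α : {α : Fin N → ℕ // ∑ j, α j = n} =>
      diagCoeff (p (∑ j, α.1 j)) α.1 * ∏ j, z j ^ α.1 j) (p n fun _ => z) := by
    intro n
    have h1 : HasSum (fun α : Fin N → ℕ => diagCoeff (p n) α * ∏ j, z j ^ α j)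
        (p n fun _ => z) := by
      rw [apply_diag_eq_sum]
      exact hasSum_sum_of_ne_finset_zero fun α hα => by rw [hzero n α hα, zero_mul]
    have h2 := (hasSum_subtype_iff_of_support_subset
      (s := {α : Fin N → ℕ | ∑ j, α j = n}) (f := fun α : Fin N → ℕ =>
        diagCoeff (p n) α * ∏ j, z j ^ α j) (fun α hα => ?_)).2 h1
    · refine h2.congr_fun fun α => ?_
      rcases α with ⟨α, rfl⟩
      rfl
    · by_contra hn
      refine hα ?_
      change diagCoeff (p n) α * _ = 0
      rw [hzero n α, zero_mul]
      intro hmem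
      obtain ⟨r, -, rfl⟩ := Finset.mem_image.1 hmem
      exact hn (sum_multiplicity r)
  have h5 := hs.sigma hfib
  rw [← h5.unique (slice z hz).1]
  exact hsum.hasSum

end Taylor

/-! ### Positive semi-definite kernels -/

section Kernels

open scoped ComplexOrder

variable {X : Set (ℕ → ℂ)} {K L : (ℕ → ℂ) → (ℕ → ℂ) → ℂ}

lemma posSemidefOn_iff : PosSemidefOn X K ↔ ∀ Y : Finset (ℕ → ℂ), (∀ z ∈ Y, z ∈ X) →
    ∀ a : (ℕ → ℂ) → ℂ, 0 ≤ ∑ z ∈ Y, ∑ w ∈ Y, a z * conj (a w) * K z w := by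
  simp only [PosSemidefOn, Complex.nonneg_iff, eq_comm]

lemma PosSemidefOn.congr (hK : PosSemidefOn X K) (h : ∀ z ∈ X, ∀ w ∈ X, K z w = L z w) :
    PosSemidefOn X L := by
  rw [posSemidefOn_iff] at hK ⊢
  intro Y hY a
  convert hK Y hY a using 1
  exact Finset.sum_congr rfl fun z hz => Finset.sum_congr rfl fun w hw => by
    rw [h z (hY z hz) w (hY w hw)]

lemma PosSemidefOn.mono {X' : Set (ℕ → ℂ)} (hK : PosSemidefOn X K) (h : X' ⊆ X) :
    PosSemidefOn X' K :=
  fun Y hY a => hK Y (fun z hz => h (hY z hz)) a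

lemma posSemidefOn_zero : PosSemidefOn X fun _ _ => 0 := fun _ _ _ => by simp

lemma PosSemidefOn.add (hK : PosSemidefOn X K) (hL : PosSemidefOn X L) :
    PosSemidefOn X fun z w => K z w + L z w := by
  rw [posSemidefOn_iff] at hK hL ⊢
  intro Y hY a
  simpa only [mul_add, Finset.sum_add_distrib] using add_nonneg (hK Y hY a) (hL Y hY a)

lemma PosSemidefOn.sum {ι : Type*} (s : Finset ι) {K : ι → (ℕ → ℂ) → (ℕ → ℂ) → ℂ}
    (hK : ∀ i ∈ s, PosSemidefOn X (K i)) : PosSemidefOn X fun z w => ∑ i ∈ s, K i z w := by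
  classical
  induction s using Finset.induction_on with
  | empty => simpa using posSemidefOn_zero
  | insert i s hi ih =>
    simp only [Finset.sum_insert hi]
    exact (hK i (by simp)).add (ih fun j hj => hK j (by simp [hj]))

/-- Only finitely many values enter each positivity condition, so a pointwise limit of kernels that
are positive semi-definite on larger and larger finite sets is positive semi-definite. -/
lemma posSemidefOn_of_tendsto {ι : Type*} {l : Filter ι} [l.NeBot]
    {K' : ι → (ℕ → ℂ) → (ℕ → ℂ) → ℂ}
    (hK' : ∀ Y : Finset (ℕ → ℂ), (∀ z ∈ Y, z ∈ X) → ∀ᶠ i in l, PosSemidefOn Y (K' i))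
    (h : ∀ z ∈ X, ∀ w ∈ X, Tendsto (fun i => K' i z w) l (𝓝 (K z w))) : PosSemidefOn X K := by
  rw [posSemidefOn_iff]
  intro Y hY a
  have ht : Tendsto (fun i => ∑ z ∈ Y, ∑ w ∈ Y, a z * conj (a w) * K' i z w) l
      (𝓝 (∑ z ∈ Y, ∑ w ∈ Y, a z * conj (a w) * K z w)) :=
    tendsto_finsetSum _ fun z hz => tendsto_finsetSum _ fun w hw =>
      (h z (hY z hz) w (hY w hw)).const_mul _
  refine ge_of_tendsto ht ?_
  filter_upwards [hK' Y hY] with i hi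
  exact posSemidefOn_iff.1 hi Y (fun z hz => hz) a

lemma PosSemidefOn.mul_conj (hK : PosSemidefOn X K) (h : (ℕ → ℂ) → ℂ) :
    PosSemidefOn X fun z w => h z * conj (h w) * K z w := by
  rw [posSemidefOn_iff] at hK ⊢
  intro Y hY a
  refine (hK Y hY fun z => a z * h z).trans_eq
    (Finset.sum_congr rfl fun z _ => Finset.sum_congr rfl fun w _ => ?_)
  simp only [map_mul]
  ring

lemma norm_mul_conj_lt_one {z w : ℕ → ℂ} (hz : z ∈ ballLinfty) (hw : w ∈ ballLinfty) (j : ℕ) :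
    ‖z j * conj (w j)‖ < 1 := by
  obtain ⟨r, hr, hzr⟩ := hz
  obtain ⟨s, hs, hws⟩ := hw
  rw [norm_mul, RCLike.norm_conj]
  exact mul_lt_one_of_nonneg_of_lt_one_left (norm_nonneg _) ((hzr j).trans_lt hr)
    ((hws j).trans hs.le)

lemma one_sub_mul_conj_ne_zero {z w : ℕ → ℂ} (hz : z ∈ ballLinfty) (hw : w ∈ ballLinfty) {j : ℕ} :
    1 - z j * conj (w j) ≠ 0 := fun h => by
  have := norm_mul_conj_lt_one hz hw j
  rw [← sub_eq_zero.1 h, norm_one] at this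
  exact lt_irrefl _ this

/-- Multiplication by the Szegő kernel of the first variable preserves positivity. -/
lemma PosSemidefOn.div_szego (hX : X ⊆ ballLinfty) (hK : PosSemidefOn X K) :
    PosSemidefOn X fun z w => (1 - z 0 * conj (w 0))⁻¹ * K z w := by
  refine posSemidefOn_of_tendsto (l := atTop)
    (K' := fun n z w => ∑ k ∈ Finset.range n, z 0 ^ k * conj (w 0 ^ k) * K z w)
    (fun Y hY => Eventually.of_forall fun n => ?_) fun z hz w hw => ?_
  · exact PosSemidefOn.sum _ fun k _ => (hK.mono hY).mul_conj fun z => z 0 ^ k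
  · have := norm_mul_conj_lt_one (hX hz) (hX hw) 0
    have := ((hasSum_geometric_of_norm_lt_one this).mul_right (K z w)).tendsto_sum_nat
    simpa [mul_pow] using this

section Inner

variable {H : Type*} [NormedAddCommGroup H] [InnerProductSpace ℂ H]

lemma sum_sum_inner (Y : Finset (ℕ → ℂ)) (a : (ℕ → ℂ) → ℂ) (u : (ℕ → ℂ) → H) :
    ∑ z ∈ Y, ∑ w ∈ Y, a z * conj (a w) * inner ℂ (u w) (u z) =
      ((‖∑ z ∈ Y, a z • u z‖ ^ 2 : ℝ) : ℂ) := by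
  have := inner_self_eq_norm_sq_to_K (𝕜 := ℂ) (∑ z ∈ Y, a z • u z)
  rw [inner_sum] at this
  simp only [sum_inner, inner_smul_left, inner_smul_right] at this
  push_cast
  rw [RCLike.ofReal_eq_complex_ofReal] at this
  rw [← this]
  refine Finset.sum_congr rfl fun z _ => ?_
  rw [Finset.mul_sum]
  exact Finset.sum_congr rfl fun w _ => by ring

lemma posSemidefOn_inner (u : (ℕ → ℂ) → H) :
    PosSemidefOn X fun z w => inner ℂ (u w) (u z) := by
  rw [posSemidefOn_iff]
  intro Y _ a
  rw [sum_sum_inner]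
  exact Complex.zero_le_real.2 (sq_nonneg _)

lemma posSemidefOn_defect {H' : Type*} [NormedAddCommGroup H'] [InnerProductSpace ℂ H']
    {V : H →L[ℂ] H'} (hV : ‖V‖ ≤ 1) (u : (ℕ → ℂ) → H) :
    PosSemidefOn X fun z w => inner ℂ (u w) (u z) - inner ℂ (V (u w)) (V (u z)) := by
  rw [posSemidefOn_iff]
  intro Y _ a
  simp only [mul_sub, Finset.sum_sub_distrib]
  rw [sum_sum_inner, sum_sum_inner Y a fun z => V (u z), ← Complex.ofReal_sub]
  simp only [← map_smul, ← map_sum]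
  norm_cast
  rw [sub_nonneg]
  gcongr
  exact V.le_of_opNorm_le_of_le hV le_rfl |>.trans (by rw [one_mul])

end Inner

lemma PosSemidefOn.conj_symm (hK : PosSemidefOn X K) {z w : ℕ → ℂ} (hz : z ∈ X) (hw : w ∈ X) :
    conj (K z w) = K w z := by
  classical
  rcases eq_or_ne z w with rfl | hne
  · have := (hK {z} (by simpa using hz) fun _ => 1).2
    simp only [Finset.sum_singleton, map_one, one_mul] at this
    exact Complex.conj_eq_iff_im.2 this
  · have hY : ∀ x ∈ ({z, w} : Finset (ℕ → ℂ)), x ∈ X := by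
      intro x hx
      rcases Finset.mem_insert.1 hx with rfl | hx
      · exact hz
      · rwa [Finset.mem_singleton.1 hx]
    have hzz := (hK {z} (by simpa using hz) fun _ => 1).2
    have hww := (hK {w} (by simpa using hw) fun _ => 1).2
    have h1 := (hK {z, w} hY fun _ => 1).2
    have h2 := (hK {z, w} hY fun x => if x = z then 1 else Complex.I).2
    simp [Finset.sum_pair hne, hne.symm] at hzz hww h1 h2
    apply Complex.ext <;> simp <;> linarith

/-- A positive semi-definite kernel is a Gram matrix. -/
lemma PosSemidefOn.exists_inner (hK : PosSemidefOn X K) :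
    ∃ (H : Type) (_ : NormedAddCommGroup H) (_ : InnerProductSpace ℂ H) (_ : CompleteSpace H)
      (u : (ℕ → ℂ) → H), ∀ z ∈ X, ∀ w ∈ X, K z w = inner ℂ (u w) (u z) := by
  classical
  let M : Matrix X X (ℂ →L[ℂ] ℂ) :=
    Matrix.of fun z w => conj (K z w) • ContinuousLinearMap.id ℂ ℂ
  have hM : M.PosSemidef := by
    have key := (RKHS.posSemidef_tfae (K := M)).out 0 2
    refine key.2 ⟨?_, fun v => ?_⟩
    · ext z w
      refine ext_inner_right ℂ fun x => ?_
      have hid : ContinuousLinearMap.adjoint (ContinuousLinearMap.id ℂ ℂ) =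
          ContinuousLinearMap.id ℂ ℂ := ContinuousLinearMap.adjoint_id
      simp [M, ContinuousLinearMap.star_eq_adjoint, hid, hK.conj_symm z.2 w.2]
    · let a : (ℕ → ℂ) → ℂ := fun z => if h : z ∈ X then v ⟨z, h⟩ else 0
      have ha : ∀ z : X, a z = v z := fun z => by simp [a]
      have := (hK (v.support.map (Function.Embedding.subtype _)) (by simp +contextual) a).1
      simp only [Finset.sum_map, Function.Embedding.subtype_apply, ha] at this
      rw [Finset.sum_comm] at this
      refine this.trans_eq (congrArg Complex.re ?_)
      simp only [Finsupp.sum, M]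
      refine Finset.sum_congr rfl fun z _ => Finset.sum_congr rfl fun w _ => ?_
      simp
      ring
  have : Fact M.PosSemidef := ⟨hM⟩
  refine ⟨RKHS.OfKernel M, inferInstance, inferInstance, inferInstance,
    fun z => if h : z ∈ X then RKHS.kerFun (RKHS.OfKernel M) ⟨z, h⟩ 1 else 0, ?_⟩
  intro z hz w hw
  have h := RKHS.kernel_inner (RKHS.OfKernel M) ⟨z, hz⟩ ⟨w, hw⟩ 1 1
  rw [RKHS.OfKernel.kernel_ofKernel] at h
  simp only [dif_pos hz, dif_pos hw]
  rw [← h]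
  simp [M]

lemma PosSemidefOn.diag (hK : PosSemidefOn X K) {z : ℕ → ℂ} (hz : z ∈ X) :
    0 ≤ (K z z).re ∧ (K z z).im = 0 := by
  simpa using hK {z} (by simpa using hz) fun _ => 1

lemma PosSemidefOn.norm_le (hK : PosSemidefOn X K) {z w : ℕ → ℂ} (hz : z ∈ X) (hw : w ∈ X) :
    ‖K z w‖ ≤ (K z z).re + (K w w).re := by
  obtain ⟨H, _, _, _, u, hu⟩ := hK.exists_inner
  have hre : ∀ x ∈ X, (K x x).re = ‖u x‖ ^ 2 := fun x hx => by
    rw [hu x hx x hx]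
    exact inner_self_eq_norm_sq (𝕜 := ℂ) (u x)
  rw [hre z hz, hre w hw, hu z hz w hw]
  refine (norm_inner_le_norm _ _).trans ?_
  nlinarith [sq_nonneg (‖u w‖ - ‖u z‖), sq_nonneg (‖u w‖), sq_nonneg (‖u z‖)]

/-- A positive semi-definite remainder in an Agler decomposition can be absorbed: divide it by
`1 - z_0 conj w_0`, which preserves positivity, and add it to the first kernel. -/
lemma hasAglerDecomposition_of_remainder (hX : X ⊆ ballLinfty) {g : (ℕ → ℂ) → ℂ}
    {K : ℕ → (ℕ → ℂ) → (ℕ → ℂ) → ℂ} (hK : ∀ j, PosSemidefOn X (K j))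
    {R : (ℕ → ℂ) → (ℕ → ℂ) → ℂ} (hR : PosSemidefOn X R)
    (h : ∀ z ∈ X, ∀ w ∈ X,
      HasSum (fun j => (1 - z j * conj (w j)) * K j z w) (1 - g z * conj (g w) - R z w)) :
    HasAglerDecomposition X g := by
  let L : ℕ → (ℕ → ℂ) → (ℕ → ℂ) → ℂ := fun j z w =>
    if j = 0 then (1 - z 0 * conj (w 0))⁻¹ * R z w else 0
  have hL : ∀ j, PosSemidefOn X (L j) := fun j => by
    rcases eq_or_ne j 0 with rfl | hj
    · simpa [L] using hR.div_szego hX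
    · simpa [L, hj] using posSemidefOn_zero
  refine ⟨fun j z w => K j z w + L j z w, fun j => (hK j).add (hL j), fun z hz w hw => ?_⟩
  have hne : 1 - z 0 * conj (w 0) ≠ 0 := one_sub_mul_conj_ne_zero (hX hz) (hX hw)
  have hs : HasSum (fun j => (1 - z j * conj (w j)) * L j z w) (R z w) := by
    convert hasSum_ite_eq 0 (R z w) using 2 with j
    rcases eq_or_ne j 0 with rfl | hj
    · simp [L, hne]
    · simp [L, hj]
  have ht := (h z hz w hw).add hs
  simp only [← mul_add, sub_add_cancel] at ht
  exact ⟨ht.summable.norm, ht⟩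

end Kernels

/-! ### Strongly convergent block diagonal operators -/

section Diagonal

variable {E : Type*} [NormedAddCommGroup E] [InnerProductSpace ℂ E]

/-- `R j` is an operator of norm at most `r` that lives on the range of `Q j`, where the `Q j` are
mutually orthogonal projections. -/
structure IsBlockDiagonal (Q R : ℕ → E →L[ℂ] E) (r : ℝ) : Prop where
  symm : ∀ j x y, inner ℂ (Q j x) y = inner ℂ x (Q j y)
  idem : ∀ j x, Q j (Q j x) = Q j x
  orth : ∀ i j, i ≠ j → ∀ x, Q i (Q j x) = 0
  right : ∀ j x, R j (Q j x) = R j x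
  left : ∀ j x, Q j (R j x) = R j x
  norm_le : ∀ j, ‖R j‖ ≤ r

namespace IsBlockDiagonal

variable {Q R : ℕ → E →L[ℂ] E} {r : ℝ}

lemma nonneg (h : IsBlockDiagonal Q R r) : 0 ≤ r := (norm_nonneg _).trans (h.norm_le 0)

lemma orthogonalFamily (h : IsBlockDiagonal Q R r) :
    OrthogonalFamily ℂ (fun j => LinearMap.range (Q j).toLinearMap)
      fun j => (LinearMap.range (Q j).toLinearMap).subtypeₗᵢ := by
  rintro i j hij ⟨_, x, rfl⟩ ⟨_, y, rfl⟩
  change inner ℂ (Q i x) (Q j y) = 0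
  rw [h.symm, h.orth i j hij, inner_zero_right]

lemma norm_sq_sum (h : IsBlockDiagonal Q R r) (s : Finset ℕ) {f : ℕ → E}
    (hf : ∀ j, Q j (f j) = f j) : ‖∑ j ∈ s, f j‖ ^ 2 = ∑ j ∈ s, ‖f j‖ ^ 2 :=
  h.orthogonalFamily.norm_sum (fun j => ⟨f j, f j, hf j⟩) s

lemma sum_norm_sq_le (h : IsBlockDiagonal Q R r) (s : Finset ℕ) (x : E) :
    ∑ j ∈ s, ‖Q j x‖ ^ 2 ≤ ‖x‖ ^ 2 := by
  have h1 := h.norm_sq_sum s (f := fun j => Q j x) fun j => h.idem j x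
  have h2 : ((∑ j ∈ s, ‖Q j x‖ ^ 2 : ℝ) : ℂ) = inner ℂ (∑ j ∈ s, Q j x) x := by
    rw [sum_inner]
    push_cast
    refine Finset.sum_congr rfl fun j _ => ?_
    rw [← h.idem j x, h.symm, inner_self_eq_norm_sq_to_K, h.idem]
    rfl
  have h3 : ‖∑ j ∈ s, Q j x‖ ^ 2 ≤ ‖∑ j ∈ s, Q j x‖ * ‖x‖ := by
    have h4 := norm_inner_le_norm (𝕜 := ℂ) (∑ j ∈ s, Q j x) x
    rw [← h2, ← h1, Complex.norm_real, Real.norm_of_nonneg (sq_nonneg _)] at h4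
    exact h4
  rw [← h1]
  have h5 : ‖∑ j ∈ s, Q j x‖ ≤ ‖x‖ := by
    by_contra! hlt
    nlinarith [norm_nonneg x, norm_nonneg (∑ j ∈ s, Q j x)]
  gcongr

lemma sum_norm_sq_apply_le (h : IsBlockDiagonal Q R r) (s : Finset ℕ) (x : E) :
    ∑ j ∈ s, ‖R j x‖ ^ 2 ≤ (r * ‖x‖) ^ 2 := by
  calc ∑ j ∈ s, ‖R j x‖ ^ 2 ≤ ∑ j ∈ s, r ^ 2 * ‖Q j x‖ ^ 2 := by
        refine Finset.sum_le_sum fun j _ => ?_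
        rw [← mul_pow, ← h.right j x]
        gcongr
        exact (R j).le_of_opNorm_le (h.norm_le j) _
    _ = r ^ 2 * ∑ j ∈ s, ‖Q j x‖ ^ 2 := by rw [Finset.mul_sum]
    _ ≤ r ^ 2 * ‖x‖ ^ 2 := by gcongr; exact h.sum_norm_sq_le s x
    _ = (r * ‖x‖) ^ 2 := by ring

lemma norm_sum_le (h : IsBlockDiagonal Q R r) (s : Finset ℕ) (x : E) :
    ‖∑ j ∈ s, R j x‖ ≤ r * ‖x‖ := by
  refine le_of_sq_le_sq ?_ (mul_nonneg h.nonneg (norm_nonneg _))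
  rw [h.norm_sq_sum s fun j => h.left j x]
  exact h.sum_norm_sq_apply_le s x

lemma summable [CompleteSpace E] (h : IsBlockDiagonal Q R r) (x : E) :
    Summable fun j => R j x := by
  refine (h.orthogonalFamily.summable_iff_norm_sq_summable
    fun j => ⟨R j x, R j x, h.left j x⟩).2 ?_
  exact summable_of_sum_le (fun _ => sq_nonneg _) fun s => h.sum_norm_sq_apply_le s x

lemma exists_isStrongSum [CompleteSpace E] (h : IsBlockDiagonal Q R r) :
    ∃ Δ : E →L[ℂ] E, IsStrongSum R Δ ∧ ‖Δ‖ ≤ r := by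
  have hs := fun x => (h.summable x).hasSum
  let L : E →ₗ[ℂ] E :=
    { toFun := fun x => ∑' j, R j x
      map_add' := fun x y => by
        refine (hs (x + y)).unique ?_
        simpa using (hs x).add (hs y)
      map_smul' := fun a x => by
        refine (hs (a • x)).unique ?_
        simpa using (hs x).const_smul a }
  have hL : ∀ x, ‖L x‖ ≤ r * ‖x‖ := fun x =>
    le_of_tendsto (hs x).norm (Eventually.of_forall fun s => h.norm_sum_le s x)
  exact ⟨L.mkContinuous r hL, hs, L.mkContinuous_norm_le h.nonneg hL⟩

lemma norm_sum_range_le (h : IsBlockDiagonal Q R r) (N : ℕ) :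
    ‖∑ j ∈ Finset.range N, R j‖ ≤ r :=
  ContinuousLinearMap.opNorm_le_bound _ h.nonneg fun x => by
    simpa using h.norm_sum_le (Finset.range N) x

end IsBlockDiagonal

lemma IsStrongSum.unique {A : ℕ → E →L[ℂ] E} {S S' : E →L[ℂ] E} (h : IsStrongSum A S)
    (h' : IsStrongSum A S') : S = S' :=
  ContinuousLinearMap.ext fun x => (h x).unique (h' x)

lemma IsStrongSum.tendsto {A : ℕ → E →L[ℂ] E} {S : E →L[ℂ] E} (h : IsStrongSum A S) (x : E) :
    Tendsto (fun N => (∑ j ∈ Finset.range N, A j) x) atTop (𝓝 (S x)) := by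
  simpa using (h x).tendsto_sum_nat

lemma isStrongSum_of_finite {A : ℕ → E →L[ℂ] E} {N : ℕ} (h : ∀ j, N ≤ j → A j = 0) :
    IsStrongSum A (∑ j ∈ Finset.range N, A j) := fun x => by
  rw [_root_.sum_apply]
  exact hasSum_sum_of_ne_finset_zero fun j hj => by
    rw [h j (by simpa using hj), _root_.zero_apply]

end Diagonal

/-! ### Contractive colligations -/

section Colligation

variable {E K : Type*} [NormedAddCommGroup E] [NormedSpace ℂ E]
  [NormedAddCommGroup K] [NormedSpace ℂ K]

/-- The transfer operator `A + B Δ (1 - D Δ)⁻¹ C`. -/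
def transferOp (A : E →L[ℂ] E) (B : K →L[ℂ] E) (C : E →L[ℂ] K) (D Δ : K →L[ℂ] K) : E →L[ℂ] E :=
  A + B ∘L Δ ∘L Ring.inverse (1 - D ∘L Δ) ∘L C

variable {A : E →L[ℂ] E} {B : K →L[ℂ] E} {C : E →L[ℂ] K} {D Δ : K →L[ℂ] K} {r : ℝ}

lemma norm_comp_le_of_le (hD : ‖D‖ ≤ 1) (hΔ : ‖Δ‖ ≤ r) : ‖D ∘L Δ‖ ≤ r :=
  (ContinuousLinearMap.opNorm_comp_le _ _).trans
    ((mul_le_mul hD hΔ (norm_nonneg _) zero_le_one).trans_eq (one_mul _))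

lemma isUnit_one_sub_comp [CompleteSpace K] (hD : ‖D‖ ≤ 1) (hΔ : ‖Δ‖ ≤ r) (hr : r < 1) :
    IsUnit (1 - D ∘L Δ) :=
  isUnit_one_sub_of_norm_lt_one ((norm_comp_le_of_le hD hΔ).trans_lt hr)

lemma inverse_apply_sub (h : IsUnit (1 - D ∘L Δ)) (y : K) :
    Ring.inverse (1 - D ∘L Δ) y - D (Δ (Ring.inverse (1 - D ∘L Δ) y)) = y := by
  have := congrArg (fun S : K →L[ℂ] K => S y) (Ring.mul_inverse_cancel _ h)
  simpa using this

lemma eq_inverse_apply (h : IsUnit (1 - D ∘L Δ)) {u y : K} (hu : u - D (Δ u) = y) :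
    u = Ring.inverse (1 - D ∘L Δ) y := by
  have := congrArg (fun S : K →L[ℂ] K => S u) (Ring.inverse_mul_cancel _ h)
  rw [← hu]
  simpa using this.symm

lemma norm_le_of_sub_eq (hD : ‖D‖ ≤ 1) (hΔ : ‖Δ‖ ≤ r) {u y : K} (hu : u - D (Δ u) = y) :
    (1 - r) * ‖u‖ ≤ ‖y‖ := by
  have h1 : ‖D (Δ u)‖ ≤ r * ‖u‖ := (D ∘L Δ).le_of_opNorm_le (norm_comp_le_of_le hD hΔ) u
  have h2 := norm_sub_norm_le u (D (Δ u))
  rw [hu] at h2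
  linarith

/-- With `u = (1 - D Δ)⁻¹ C x`, the colligation maps `(x, Δ u)` to `(transferOp x, u)`; as it is
contractive and `‖Δ u‖ ≤ ‖u‖`, so is the transfer operator. -/
lemma norm_transferOp_le (h : ∀ x k, ‖A x + B k‖ ^ 2 + ‖C x + D k‖ ^ 2 ≤ ‖x‖ ^ 2 + ‖k‖ ^ 2)
    (hΔ : ‖Δ‖ ≤ 1) (hu : IsUnit (1 - D ∘L Δ)) : ‖transferOp A B C D Δ‖ ≤ 1 := by
  refine ContinuousLinearMap.opNorm_le_bound _ zero_le_one fun x => ?_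
  have h1 := inverse_apply_sub hu (C x)
  set u := Ring.inverse (1 - D ∘L Δ) (C x)
  have h2 := h x (Δ u)
  rw [← sub_eq_iff_eq_add.1 h1] at h2
  have h3 : ‖Δ u‖ ≤ ‖u‖ := by simpa using Δ.le_of_opNorm_le hΔ u
  have h4 : transferOp A B C D Δ x = A x + B (Δ u) := rfl
  rw [h4, one_mul]
  refine le_of_sq_le_sq ?_ (norm_nonneg _)
  have : ‖Δ u‖ ^ 2 ≤ ‖u‖ ^ 2 := by gcongr
  linarith

/-- The transfer operator depends strongly continuously on block operators `Δ` that are uniformly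
bounded by some `r < 1`. -/
lemma tendsto_transferOp_apply [CompleteSpace K] (hD : ‖D‖ ≤ 1) (hr : r < 1) {ΔN : ℕ → K →L[ℂ] K}
    (hN : ∀ N, ‖ΔN N‖ ≤ r) (hΔ : ‖Δ‖ ≤ r) (h : ∀ k, Tendsto (fun N => ΔN N k) atTop (𝓝 (Δ k)))
    (x : E) :
    Tendsto (fun N => transferOp A B C D (ΔN N) x) atTop (𝓝 (transferOp A B C D Δ x)) := by
  have h1 := inverse_apply_sub (isUnit_one_sub_comp hD hΔ hr) (C x)
  set u := Ring.inverse (1 - D ∘L Δ) (C x)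
  have hd : Tendsto (fun N => ‖ΔN N u - Δ u‖) atTop (𝓝 0) :=
    tendsto_iff_norm_sub_tendsto_zero.1 (h u)
  have hu : Tendsto (fun N => Ring.inverse (1 - D ∘L ΔN N) (C x)) atTop (𝓝 u) := by
    rw [tendsto_iff_norm_sub_tendsto_zero]
    refine squeeze_zero (fun _ => norm_nonneg _) (fun N => ?_)
      (by simpa using hd.const_mul (1 - r)⁻¹)
    have h2 := inverse_apply_sub (isUnit_one_sub_comp hD (hN N) hr) (C x)
    set v := Ring.inverse (1 - D ∘L ΔN N) (C x)
    -- the resolvent identity, applied to `C x`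
    have h3 : (v - u) - D (ΔN N (v - u)) = D (ΔN N u - Δ u) := by
      rw [map_sub, map_sub, map_sub, ← sub_eq_zero]
      rw [← sub_eq_zero] at h1 h2
      have : v - D (ΔN N v) - (u - D (Δ u)) = 0 := by
        rw [sub_eq_zero.1 h1, sub_eq_zero.1 h2, sub_self]
      rw [← this]
      abel
    have h4 := norm_le_of_sub_eq hD (hN N) h3
    have h5 : ‖D (ΔN N u - Δ u)‖ ≤ ‖ΔN N u - Δ u‖ := by
      simpa using D.le_of_opNorm_le hD (ΔN N u - Δ u)
    rw [inv_mul_eq_div, le_div_iff₀ (by linarith), mul_comm]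
    exact h4.trans h5
  have hΔu : Tendsto (fun N => ΔN N (Ring.inverse (1 - D ∘L ΔN N) (C x))) atTop (𝓝 (Δ u)) := by
    have h6 : Tendsto (fun N => ΔN N (Ring.inverse (1 - D ∘L ΔN N) (C x) - u)) atTop (𝓝 0) := by
      refine squeeze_zero_norm (fun N => (ΔN N).le_of_opNorm_le (hN N) _) ?_
      simpa using (tendsto_iff_norm_sub_tendsto_zero.1 hu).const_mul r
    simpa using h6.add (h u)
  exact ((B.continuous.tendsto _).comp hΔu).const_add (A x)

end Colligation

/-! ### Contractions on the state space -/

section StateSpace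

variable {H : ℕ → Type*} [∀ j, NormedAddCommGroup (H j)] [∀ j, InnerProductSpace ℂ (H j)]

lemma stateSpace_apply (V : StateSpace H →L[ℂ] StateSpace H) (x : ℂ) (k : HilbertSum H) :
    V (WithLp.toLp 2 (x, k)) =
      WithLp.toLp 2 (blockA V x + blockB V k, blockC V x + blockD V k) := by
  have h : WithLp.toLp 2 (x, k) = (inclScalar x + inclSum k : StateSpace H) := by
    simp [inclScalar, inclSum, ← WithLp.toLp_add]
  rw [h, map_add]
  rfl

lemma block_norm_sq_le {V : StateSpace H →L[ℂ] StateSpace H} (hV : ‖V‖ ≤ 1) (x : ℂ)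
    (k : HilbertSum H) :
    ‖blockA V x + blockB V k‖ ^ 2 + ‖blockC V x + blockD V k‖ ^ 2 ≤ ‖x‖ ^ 2 + ‖k‖ ^ 2 := by
  have h := V.le_of_opNorm_le hV (WithLp.toLp 2 (x, k))
  rw [stateSpace_apply, one_mul] at h
  have h2 := pow_le_pow_left₀ (norm_nonneg _) h 2
  rw [WithLp.prod_norm_sq_eq_of_L2, WithLp.prod_norm_sq_eq_of_L2] at h2
  simpa using h2

lemma norm_blockD_le {V : StateSpace H →L[ℂ] StateSpace H} (hV : ‖V‖ ≤ 1) : ‖blockD V‖ ≤ 1 := by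
  refine ContinuousLinearMap.opNorm_le_bound _ zero_le_one fun k => ?_
  have h := block_norm_sq_le hV 0 k
  simp only [map_zero, zero_add, norm_zero, ne_eq, OfNat.ofNat_ne_zero, not_false_eq_true,
    zero_pow] at h
  rw [one_mul]
  refine le_of_sq_le_sq ?_ (norm_nonneg _)
  linarith [sq_nonneg ‖blockB V k‖]

lemma norm_blockC_one_le {V : StateSpace H →L[ℂ] StateSpace H} (hV : ‖V‖ ≤ 1) :
    ‖blockC V 1‖ ≤ 1 := by
  have h := block_norm_sq_le hV 1 0
  simp only [map_zero, add_zero, norm_zero, norm_one, ne_eq, OfNat.ofNat_ne_zero,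
    not_false_eq_true, zero_pow, one_pow] at h
  refine le_of_sq_le_sq ?_ zero_le_one
  linarith [sq_nonneg ‖blockA V 1‖]

lemma proj_apply (j : ℕ) (k : HilbertSum H) (i : ℕ) : proj H j k i = if i = j then k i else 0 := by
  change (lp.single 2 j (k j) : lp H 2) i = _
  rcases eq_or_ne i j with rfl | h
  · simp
  · simp [h]

lemma norm_proj_le (j : ℕ) : ‖proj H j‖ ≤ 1 := by
  refine ContinuousLinearMap.opNorm_le_bound _ zero_le_one fun k => ?_
  rw [one_mul]
  change ‖(lp.single 2 j (k j) : lp H 2)‖ ≤ _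
  rw [lp.norm_single (by norm_num)]
  exact lp.norm_apply_le_norm (by norm_num) k j

lemma inner_proj (j : ℕ) (k l : HilbertSum H) :
    inner ℂ (proj H j k) l = inner ℂ k (proj H j l) := by
  change inner ℂ (lp.single 2 j (k j) : lp H 2) l = inner ℂ k (lp.single 2 j (l j) : lp H 2)
  rw [lp.inner_single_left, lp.inner_single_right]

lemma proj_proj (i j : ℕ) (k : HilbertSum H) :
    proj H i (proj H j k) = if i = j then proj H j k else 0 := by
  ext m
  split_ifs with h <;> simp only [proj_apply, lp.coeFn_zero, Pi.zero_apply]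
  · subst h; split_ifs <;> rfl
  · split_ifs with h1 h2
    · exact (h (h1.symm.trans h2)).elim
    · rfl
    · rfl

lemma isBlockDiagonal_proj {z : ℕ → ℂ} {r : ℝ} (hz : ∀ j, ‖z j‖ ≤ r) :
    IsBlockDiagonal (proj H) (fun j => z j • proj H j) r where
  symm := inner_proj
  idem j x := by simp [proj_proj]
  orth i j h x := by simp [proj_proj, h]
  right j x := by simp [proj_proj]
  left j x := by simp [proj_proj]
  norm_le j := by
    rw [norm_smul]
    exact (mul_le_of_le_one_right (norm_nonneg _) (norm_proj_le j)).trans (hz j)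

lemma IsStrongSum.apply_coord {z : ℕ → ℂ} {Δ : HilbertSum H →L[ℂ] HilbertSum H}
    (h : IsStrongSum (fun j => z j • proj H j) Δ) (k : HilbertSum H) (i : ℕ) :
    Δ k i = z i • k i := by
  refine ((h k).mapL (lp.evalCLM ℂ H 2 i)).unique ?_
  convert hasSum_ite_eq i (z i • k i) using 2 with j
  change (z j • proj H j k) i = _
  rw [lp.coeFn_smul, Pi.smul_apply, proj_apply]
  rcases eq_or_ne i j with rfl | hij
  · simp
  · simp [hij, hij.symm]

/-- The diagonal operator `∑ z_j P_j`. -/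
lemma exists_diagonal [∀ j, CompleteSpace (H j)] {z : ℕ → ℂ} {r : ℝ} (hz : ∀ j, ‖z j‖ ≤ r) :
    ∃ Δ : HilbertSum H →L[ℂ] HilbertSum H, IsStrongSum (fun j => z j • proj H j) Δ ∧ ‖Δ‖ ≤ r :=
  (isBlockDiagonal_proj hz).exists_isStrongSum

end StateSpace

/-! ### Transfer functions and Agler decompositions -/

section Lurking

/-- The lurking contraction: if two families of vectors have the same Gram matrix, some contraction
maps one to the other. It is isometric on the closed span of the first family and vanishes on the
orthogonal complement. -/
lemma exists_contraction_of_inner_eq {ι F G : Type*} [NormedAddCommGroup F]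
    [InnerProductSpace ℂ F] [CompleteSpace F] [NormedAddCommGroup G] [InnerProductSpace ℂ G]
    [CompleteSpace G] (p : ι → F) (q : ι → G)
    (h : ∀ i j, inner ℂ (p i) (p j) = inner ℂ (q i) (q j)) :
    ∃ V : F →L[ℂ] G, ‖V‖ ≤ 1 ∧ ∀ i, V (p i) = q i := by
  let Lp := Finsupp.linearCombination ℂ p
  let Lq := Finsupp.linearCombination ℂ q
  have hnorm : ∀ f, ‖Lq f‖ = ‖Lp f‖ := by
    intro f
    have : inner ℂ (Lq f) (Lq f) = inner ℂ (Lp f) (Lp f) := by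
      simp only [Lp, Lq, Finsupp.linearCombination_apply, Finsupp.sum, sum_inner, inner_sum,
        inner_smul_left, inner_smul_right, h]
    rw [inner_self_eq_norm_sq_to_K, inner_self_eq_norm_sq_to_K] at this
    have h2 : ‖Lq f‖ ^ 2 = ‖Lp f‖ ^ 2 := by exact_mod_cast this
    exact (sq_eq_sq₀ (norm_nonneg _) (norm_nonneg _)).1 h2
  let M := (LinearMap.range Lp).topologicalClosure
  have hM : ∀ f, Lp f ∈ M := fun f => subset_closure ⟨f, rfl⟩
  let e : (ι →₀ ℂ) →ₗ[ℂ] M := Lp.codRestrict M hM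
  have he : DenseRange e := by
    rintro ⟨x, hx⟩
    rw [closure_subtype]
    convert hx using 1
    change _ ∈ closure _ ↔ x ∈ closure _
    congr! 2
    ext y
    simp [e]
  have hbound : ∀ f, ‖Lq f‖ ≤ 1 * ‖e f‖ := fun f => by
    rw [one_mul, hnorm]; exact le_rfl
  have : CompleteSpace M := (Submodule.isClosed_topologicalClosure _).completeSpace_coe
  refine ⟨Lq.extendOfNorm e ∘L M.orthogonalProjectionOnto, ?_, fun i => ?_⟩
  · refine (ContinuousLinearMap.opNorm_comp_le _ _).trans ?_
    exact mul_le_one₀ (LinearMap.opNorm_extendOfNorm_le he zero_le_one hbound) (norm_nonneg _)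
      (Submodule.orthogonalProjectionOnto_norm_le _)
  · have h1 : (e (Finsupp.single i 1) : F) = p i := by simp [e, Lp]
    rw [ContinuousLinearMap.comp_apply, ← h1,
      Submodule.orthogonalProjectionOnto_mem_subspace_eq_self,
      LinearMap.extendOfNorm_eq he ⟨1, hbound⟩]
    simp [Lq]

end Lurking

section Equivalence

variable {X : Set (ℕ → ℂ)} {g : (ℕ → ℂ) → ℂ}

/-- Here `u z = (1 - D Δ(z))⁻¹ C` and `y z = Δ(z) (u z)`, the kernels are the Gram kernels of the
components of `u`, and the remainder is the defect of `V` on the vectors `(1, y z)`. -/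
lemma HasTransferRealization.hasAglerDecomposition (hX : X ⊆ ballLinfty)
    (h : HasTransferRealization X g) : HasAglerDecomposition X g := by
  obtain ⟨H, _, _, _, V, hV, hg⟩ := h
  have key : ∀ z ∈ X, ∃ u y : HilbertSum H, (∀ j, y j = z j • u j) ∧
      V (WithLp.toLp 2 (1, y)) = WithLp.toLp 2 (g z, u) := by
    intro z hz
    obtain ⟨Δ, hΔ, hu, hw⟩ := hg z hz
    have h1 := inverse_apply_sub hu (blockC V 1)
    refine ⟨Ring.inverse (1 - blockD V ∘L Δ) (blockC V 1),
      Δ (Ring.inverse (1 - blockD V ∘L Δ) (blockC V 1)), fun j => hΔ.apply_coord _ j, ?_⟩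
    rw [stateSpace_apply, hw, ← sub_eq_iff_eq_add.1 h1]
    rfl
  choose! u y hy hVy using key
  let p : (ℕ → ℂ) → StateSpace H := fun z => WithLp.toLp 2 (1, y z)
  refine hasAglerDecomposition_of_remainder hX
    (K := fun j z w => inner ℂ (u w j) (u z j)) (fun j => posSemidefOn_inner fun z => u z j)
    (posSemidefOn_defect hV p) fun z hz w hw => ?_
  have h1 := lp.hasSum_inner (𝕜 := ℂ) (u w) (u z)
  have h2 := lp.hasSum_inner (𝕜 := ℂ) (y w) (y z)
  have h3 := h1.sub h2
  simp only [p, hVy z hz, hVy w hw, WithLp.prod_inner_apply]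
  have hval : 1 - g z * conj (g w) - (inner ℂ (1 : ℂ) 1 + inner ℂ (y w) (y z) -
      (inner ℂ (g w) (g z) + inner ℂ (u w) (u z))) =
        inner ℂ (u w) (u z) - inner ℂ (y w) (y z) := by
    simp only [RCLike.inner_apply, map_one]
    ring
  rw [hval]
  refine h3.congr_fun fun j => ?_
  rw [hy w hw, hy z hz, inner_smul_left, inner_smul_right]
  ring

/-- The lurking contraction argument: the decomposition equates the Gram matrices of the vectors
`(1, Δ(z) U(z))` and `(g z, U(z))`. Since `|z_j| ≤ r < 1` for all `j`, absolute convergence on the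
diagonal puts the components of `U(z)` in the Hilbert sum. -/
lemma HasAglerDecomposition.hasTransferRealization (hX : X ⊆ ballLinfty)
    (h : HasAglerDecomposition X g) : HasTransferRealization X g := by
  obtain ⟨K, hK, hKg⟩ := h
  choose H i1 i2 i3 u hu using fun j => (hK j).exists_inner
  have hmem : ∀ z ∈ X, Memℓp (fun j => u j z) 2 := by
    intro z hz
    obtain ⟨r, hr, hzr⟩ := hX hz
    have hr0 : 0 ≤ r := (norm_nonneg _).trans (hzr 0)
    refine memℓp_gen ?_
    have hs := (hKg z hz z hz).1.mul_left (1 - r ^ 2)⁻¹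
    have hr2 : 0 < 1 - r ^ 2 := by nlinarith
    refine Summable.of_nonneg_of_le (fun _ => by positivity) (fun j => ?_) hs
    have h1 : K j z z = ((‖u j z‖ ^ 2 : ℝ) : ℂ) := by
      rw [hu j z hz z hz, inner_self_eq_norm_sq_to_K]; simp
    have h2 : ‖1 - z j * conj (z j)‖ = 1 - ‖z j‖ ^ 2 := by
      rw [Complex.mul_conj, Complex.normSq_eq_norm_sq]
      rw [← Complex.ofReal_one, ← Complex.ofReal_sub, Complex.norm_real, Real.norm_of_nonneg]
      have := hzr j
      nlinarith [norm_nonneg (z j)]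
    rw [norm_mul, h1, h2, Complex.norm_real, Real.norm_of_nonneg (sq_nonneg _), inv_mul_eq_div,
      le_div_iff₀ hr2]
    simp only [ENNReal.toReal_ofNat, Real.rpow_two]
    rw [mul_comm]
    have h3 : ‖z j‖ ^ 2 ≤ r ^ 2 := by gcongr; exact hzr j
    gcongr
  let U : X → HilbertSum H := fun z => ⟨fun j => u j z, hmem z z.2⟩
  have hΔ : ∀ z : X, ∃ Δ : HilbertSum H →L[ℂ] HilbertSum H,
      IsStrongSum (fun j => z.1 j • proj H j) Δ ∧ ∃ r < 1, ‖Δ‖ ≤ r := fun z => by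
    obtain ⟨r, hr, hzr⟩ := hX z.2
    obtain ⟨Δ, h1, h2⟩ := exists_diagonal (H := H) hzr
    exact ⟨Δ, h1, r, hr, h2⟩
  choose Δ hΔ hΔr using hΔ
  obtain ⟨V, hV, hVp⟩ := exists_contraction_of_inner_eq (F := StateSpace H) (G := StateSpace H)
    (fun z : X => WithLp.toLp 2 (1, Δ z (U z))) (fun z : X => WithLp.toLp 2 (g z, U z)) (by
      intro w z
      simp only [WithLp.prod_inner_apply]
      have h1 := lp.hasSum_inner (𝕜 := ℂ) (U w) (U z)
      have h2 := lp.hasSum_inner (𝕜 := ℂ) (Δ w (U w)) (Δ z (U z))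
      have h3 := (h1.sub h2).unique (a₂ := 1 - g z * conj (g w)) (by
        refine (hKg z z.2 w w.2).2.congr_fun fun j => ?_
        rw [(hΔ w).apply_coord, (hΔ z).apply_coord, inner_smul_left, inner_smul_right,
          hu j z z.2 w w.2]
        simp only [U]
        ring)
      simp only [RCLike.inner_apply, map_one, mul_one]
      linear_combination -h3)
  refine ⟨H, i1, i2, i3, V, hV, fun z hz => ?_⟩
  obtain ⟨r, hr, hr'⟩ := hΔr ⟨z, hz⟩
  have hunit := isUnit_one_sub_comp (norm_blockD_le hV) hr' hr
  refine ⟨Δ ⟨z, hz⟩, hΔ ⟨z, hz⟩, hunit, ?_⟩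
  have h1 := hVp ⟨z, hz⟩
  rw [stateSpace_apply] at h1
  have h2 : blockA V 1 + blockB V (Δ ⟨z, hz⟩ (U ⟨z, hz⟩)) = g z := congrArg WithLp.fst h1
  have h3 : blockC V 1 + blockD V (Δ ⟨z, hz⟩ (U ⟨z, hz⟩)) = U ⟨z, hz⟩ :=
    congrArg WithLp.snd h1
  have h4 := eq_inverse_apply hunit (u := U ⟨z, hz⟩) (y := blockC V 1)
    (sub_eq_iff_eq_add.2 h3.symm)
  rw [← h2]
  change _ = blockA V 1 + blockB V (Δ ⟨z, hz⟩ (Ring.inverse (1 - blockD V ∘L Δ ⟨z, hz⟩)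
    (blockC V 1)))
  rw [← h4]

end Equivalence

/-! ### Agler's theorem on finite sets -/

section FiniteAgler

/-- The rank one kernel `a(z) conj a(w)`, cut off outside of `Y`. -/
def rankOne (Y : Finset (ℕ → ℂ)) (a : (ℕ → ℂ) → ℂ) : (ℕ → ℂ) → (ℕ → ℂ) → ℂ :=
  open scoped Classical in
  fun z w => (if z ∈ Y then a z else 0) * conj (if w ∈ Y then a w else 0)

lemma posSemidefOn_rankOne (X : Set (ℕ → ℂ)) (Y : Finset (ℕ → ℂ)) (a : (ℕ → ℂ) → ℂ) :
    PosSemidefOn X (rankOne Y a) := by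
  classical
  refine (posSemidefOn_inner (H := ℂ) fun z => if z ∈ Y then a z else 0).congr fun z _ w _ => ?_
  simp [rankOne]

/-- A real functional on kernels that is nonnegative on the rank one kernels, made strictly positive
by adding a multiple of the identity, is the Gram form of vectors of a Hilbert space. -/
lemma exists_gram_of_functional (L : ((ℕ → ℂ) → (ℕ → ℂ) → ℂ) →ₗ[ℝ] ℝ) (Y : Finset (ℕ → ℂ))
    (hL : ∀ a, 0 ≤ L (rankOne Y a)) {ε : ℝ} (hε : 0 ≤ ε) :
    ∃ (H : Type) (_ : NormedAddCommGroup H) (_ : InnerProductSpace ℂ H) (_ : CompleteSpace H)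
      (u : (ℕ → ℂ) → H), ∀ a : (ℕ → ℂ) → ℂ,
        ‖∑ z ∈ Y, a z • u z‖ ^ 2 = L (rankOne Y a) + ε * ∑ z ∈ Y, ‖a z‖ ^ 2 := by
  classical
  let unit : ℂ → (ℕ → ℂ) → (ℕ → ℂ) → ((ℕ → ℂ) → (ℕ → ℂ) → ℂ) :=
    fun c z w => Pi.single z (Pi.single w c)
  -- the complex linear functional with real part `L`, on elementary kernels
  let ℓ : (ℕ → ℂ) → (ℕ → ℂ) → ℂ := fun z w =>
    (L (unit 1 z w) : ℂ) - Complex.I * L (unit Complex.I z w)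
  have hℓ : ∀ (c : ℂ) z w, L (unit c z w) = (c * ℓ z w).re := by
    intro c z w
    have : unit c z w = c.re • unit 1 z w + c.im • unit Complex.I z w := by
      ext x y
      simp only [unit, Pi.add_apply, Pi.smul_apply]
      rcases eq_or_ne x z with rfl | hx
      · rcases eq_or_ne y w with rfl | hy
        · simp
        · simp [hy]
      · simp [hx]
    rw [this, map_add, map_smul, map_smul]
    simp [ℓ]
  have hrank : ∀ a, rankOne Y a = ∑ z ∈ Y, ∑ w ∈ Y, unit (a z * conj (a w)) z w := by
    intro a
    ext x y
    simp only [Finset.sum_apply, unit]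
    have : ∀ z w, (Pi.single z (Pi.single w (a z * conj (a w)) : (ℕ → ℂ) → ℂ) :
        (ℕ → ℂ) → (ℕ → ℂ) → ℂ) x y =
          if x = z then if y = w then a z * conj (a w) else 0 else 0 := by
      intro z w
      rcases eq_or_ne x z with rfl | hx
      · simp [Pi.single_apply]
      · simp [hx]
    simp only [this, rankOne]
    rw [Finset.sum_comm]
    simp only [Finset.sum_ite_eq]
    by_cases hx : x ∈ Y <;> by_cases hy : y ∈ Y <;> simp [hx, hy]
  -- the Hermitian part of `ℓ`, which carries the values of `L` on rank one kernels, plus `ε` times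
  -- the identity
  let Λ : (ℕ → ℂ) → (ℕ → ℂ) → ℂ := fun z w =>
    (ℓ z w + conj (ℓ w z)) / 2 + if z = w then (ε : ℂ) else 0
  have hform : ∀ a : (ℕ → ℂ) → ℂ, ∑ z ∈ Y, ∑ w ∈ Y, a z * conj (a w) * Λ z w =
      ((L (rankOne Y a) + ε * ∑ z ∈ Y, ‖a z‖ ^ 2 : ℝ) : ℂ) := by
    intro a
    have h1 : ((L (rankOne Y a) : ℝ) : ℂ) =
        ((∑ z ∈ Y, ∑ w ∈ Y, a z * conj (a w) * ℓ z w) +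
          conj (∑ z ∈ Y, ∑ w ∈ Y, a z * conj (a w) * ℓ z w)) / 2 := by
      rw [hrank, Complex.add_conj]
      simp only [map_sum, hℓ, Complex.re_sum]
      push_cast
      ring
    have h2 : conj (∑ z ∈ Y, ∑ w ∈ Y, a z * conj (a w) * ℓ z w) =
        ∑ z ∈ Y, ∑ w ∈ Y, a z * conj (a w) * conj (ℓ w z) := by
      rw [Finset.sum_comm]
      simp only [map_sum, map_mul, Complex.conj_conj]
      exact Finset.sum_congr rfl fun z _ => Finset.sum_congr rfl fun w _ => by ring
    have h3 : ∑ z ∈ Y, ∑ w ∈ Y, a z * conj (a w) * (if z = w then (ε : ℂ) else 0) =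
        ((ε * ∑ z ∈ Y, ‖a z‖ ^ 2 : ℝ) : ℂ) := by
      push_cast
      rw [Finset.mul_sum]
      refine Finset.sum_congr rfl fun z hz => ?_
      simp only [mul_ite, mul_zero, Finset.sum_ite_eq, hz, if_true]
      rw [Complex.mul_conj, Complex.normSq_eq_norm_sq]
      push_cast
      ring
    rw [Complex.ofReal_add, h1, h2, ← h3, ← Finset.sum_add_distrib, Finset.sum_div,
      ← Finset.sum_add_distrib]
    refine Finset.sum_congr rfl fun z _ => ?_
    rw [← Finset.sum_add_distrib, Finset.sum_div, ← Finset.sum_add_distrib]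
    refine Finset.sum_congr rfl fun w _ => ?_
    simp only [Λ]
    ring
  have hΛ : PosSemidefOn (Y : Set (ℕ → ℂ)) Λ := by
    intro Y' hY' a
    have h := hform fun z => if z ∈ Y' then a z else 0
    have hsub : Y' ⊆ Y := hY'
    have hcut : ∑ z ∈ Y, ∑ w ∈ Y, (if z ∈ Y' then a z else 0) *
        conj (if w ∈ Y' then a w else 0) * Λ z w =
        ∑ z ∈ Y', ∑ w ∈ Y', a z * conj (a w) * Λ z w := by
      rw [← Finset.sum_subset hsub fun z _ hz => by simp [hz]]
      refine Finset.sum_congr rfl fun z hz => ?_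
      rw [← Finset.sum_subset hsub fun w _ hw => by simp [hw]]
      exact Finset.sum_congr rfl fun w hw => by simp [hz, hw]
    rw [hcut] at h
    rw [h, Complex.ofReal_re, Complex.ofReal_im]
    exact ⟨add_nonneg (hL _) (by positivity), rfl⟩
  obtain ⟨H, i1, i2, i3, u, hu⟩ := hΛ.exists_inner
  refine ⟨H, i1, i2, i3, u, fun a => ?_⟩
  have h1 := sum_sum_inner Y a u
  have h2 : ∑ z ∈ Y, ∑ w ∈ Y, a z * conj (a w) * inner ℂ (u w) (u z) =
      ∑ z ∈ Y, ∑ w ∈ Y, a z * conj (a w) * Λ z w :=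
    Finset.sum_congr rfl fun z hz => Finset.sum_congr rfl fun w hw => by rw [hu z hz w hw]
  rw [h2, hform] at h1
  exact_mod_cast h1.symm

/-- Vectors on which the coordinates act as strict contractions are joint eigenvectors of commuting
strict contractions. -/
lemma exists_commuting_contractions {H : Type} [NormedAddCommGroup H] [InnerProductSpace ℂ H]
    [CompleteSpace H] (Y : Finset (ℕ → ℂ)) (u : (ℕ → ℂ) → H) {N : ℕ} {θ : ℝ} (hθ : 0 ≤ θ)
    (h : ∀ j < N, ∀ a : (ℕ → ℂ) → ℂ,
      ‖∑ z ∈ Y, (a z * z j) • u z‖ ≤ θ * ‖∑ z ∈ Y, a z • u z‖) :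
    ∃ (E : Type) (_ : NormedAddCommGroup E) (_ : InnerProductSpace ℂ E) (_ : CompleteSpace E)
      (T : Fin N → E →L[ℂ] E) (v : (ℕ → ℂ) → E), (∀ i j, Commute (T i) (T j)) ∧
      (∀ j, ‖T j‖ ≤ θ) ∧ (∀ z ∈ Y, ∀ j : Fin N, T j (v z) = z j • v z) ∧
      ∀ a : (ℕ → ℂ) → ℂ, ‖∑ z ∈ Y, a z • v z‖ = ‖∑ z ∈ Y, a z • u z‖ := by
  classical
  let Lu : ((ℕ → ℂ) → ℂ) →ₗ[ℂ] H := ∑ z ∈ Y, (LinearMap.proj z).smulRight (u z)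
  have hLu : ∀ a, Lu a = ∑ z ∈ Y, a z • u z := fun a => by simp [Lu]
  let M := (LinearMap.range Lu).topologicalClosure
  have hM : ∀ f, Lu f ∈ M := fun f => subset_closure ⟨f, rfl⟩
  let e : ((ℕ → ℂ) → ℂ) →ₗ[ℂ] M := Lu.codRestrict M hM
  have he : DenseRange e := by
    rintro ⟨x, hx⟩
    rw [closure_subtype]
    convert hx using 1
    change _ ∈ closure _ ↔ x ∈ closure _
    congr! 2
    ext y
    simp [e]
  have hM' : CompleteSpace M := (Submodule.isClosed_topologicalClosure _).completeSpace_coe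
  -- multiplication by the coordinates of the points, which descends to the span of the `u z`
  let m : ℕ → ((ℕ → ℂ) → ℂ) →ₗ[ℂ] ((ℕ → ℂ) → ℂ) := fun j =>
    { toFun := fun a z => a z * z j
      map_add' := fun a b => by ext z; simp [add_mul]
      map_smul' := fun c a => by ext z; simp [mul_assoc] }
  have hbound : ∀ j : Fin N, ∀ a, ‖(e ∘ₗ m j) a‖ ≤ θ * ‖e a‖ := by
    intro j a
    have := h j j.2 a
    rw [← hLu fun z => a z * z j, ← hLu a] at this
    exact this
  let T : Fin N → M →L[ℂ] M := fun j => (e ∘ₗ m j).extendOfNorm e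
  have hT : ∀ j a, T j (e a) = e (m j a) := fun j a =>
    LinearMap.extendOfNorm_eq he ⟨θ, hbound j⟩ a
  have hnorm : ∀ a, ‖e a‖ = ‖Lu a‖ := fun a => rfl
  refine ⟨M, inferInstance, inferInstance, hM', T, fun z => e (Pi.single z 1), fun i j => ?_,
    fun j => LinearMap.opNorm_extendOfNorm_le he hθ (hbound j), fun z hz j => ?_, fun a => ?_⟩
  · refine ContinuousLinearMap.ext fun x => ?_
    refine he.induction_on (p := fun x => (T i * T j) x = (T j * T i) x) x
      (isClosed_eq (T i * T j).continuous (T j * T i).continuous) fun a => ?_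
    simp only [mul_apply_eq_comp, hT]
    congr 1
    ext z
    simp only [m, LinearMap.coe_mk, AddHom.coe_mk]
    ring
  · rw [hT, ← map_smul]
    congr 1
    ext w
    rcases eq_or_ne w z with rfl | hw
    · simp [m]
    · simp [m, hw]
  · have : ∑ z ∈ Y, a z • e (Pi.single z 1) = e a := by
      apply Subtype.ext
      change M.subtype _ = Lu a
      rw [map_sum, hLu]
      refine Finset.sum_congr rfl fun z hz => ?_
      change a z • Lu (Pi.single z 1) = _
      rw [hLu]
      congr 1
      rw [Finset.sum_eq_single z]
      · simp
      · intro w _ hw; simp [hw]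
      · intro hz'; exact (hz' hz).elim
    rw [this, hnorm, hLu]

lemma extendByZero_eq {N : ℕ} {z : ℕ → ℂ} (hz : ∀ j, N ≤ j → z j = 0) :
    extendByZero (fun j : Fin N => z j) = z := by
  ext j
  rcases lt_or_ge j N with h | h
  · simp [extendByZero, h]
  · simp [extendByZero, not_lt.2 h, hz j h]

lemma mem_polydisk_of_mem_ballLinfty {N : ℕ} {z : ℕ → ℂ} (hz : z ∈ ballLinfty) :
    (fun j : Fin N => z j) ∈ polydisk N := fun j => by
  obtain ⟨r, hr, h⟩ := hz
  exact (h j).trans_lt hr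

/-- A function of the Agler class contracts every Hermitian form on a finite set of points that is
contracted by the coordinates. -/
lemma AglerClassInfty.functional_nonneg {f : (ℕ → ℂ) → ℂ} (hf : AglerClassInfty f)
    {Y : Finset (ℕ → ℂ)} (hY : ∀ z ∈ Y, z ∈ ballLinfty) {N : ℕ}
    (hN : ∀ z ∈ Y, ∀ j, N ≤ j → z j = 0) (L : ((ℕ → ℂ) → (ℕ → ℂ) → ℂ) →ₗ[ℝ] ℝ)
    (hL : ∀ a, 0 ≤ L (rankOne Y a))
    (hLj : ∀ j < N, ∀ a, L (rankOne Y fun z => a z * z j) ≤ L (rankOne Y a)) :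
    L (rankOne Y f) ≤ L (rankOne Y 1) := by
  have hr : ∃ r : ℝ, 0 ≤ r ∧ r < 1 ∧ ∀ z ∈ Y, ∀ j, ‖z j‖ ≤ r := by
    choose! r hr hzr using hY
    rcases Y.eq_empty_or_nonempty with rfl | hne
    · exact ⟨0, le_rfl, one_pos, by simp⟩
    · refine ⟨Y.sup' hne r, ?_, (Finset.sup'_lt_iff hne).2 hr,
        fun z hz j => (hzr z hz j).trans (Finset.le_sup' r hz)⟩
      obtain ⟨z, hz⟩ := hne
      exact ((norm_nonneg _).trans (hzr z hz 0)).trans (Finset.le_sup' r hz)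
  obtain ⟨r, hr0, hr1, hzr⟩ := hr
  refine le_of_forall_pos_le_add fun δ hδ => ?_
  obtain ⟨ε, hε, hεδ⟩ : ∃ ε : ℝ, 0 < ε ∧ ε * Y.card ≤ δ := by
    refine ⟨δ / (Y.card + 1), by positivity, ?_⟩
    rw [div_mul_eq_mul_div, div_le_iff₀ (by positivity)]
    nlinarith
  obtain ⟨H, _, _, _, u, hu⟩ := exists_gram_of_functional L Y hL hε.le
  -- `C` bounds the Gram form, so that the gain `ε (1 - r ^ 2)` makes the contractions strict
  set C : ℝ := ∑ z ∈ Y, ‖u z‖ ^ 2 + ε with hC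
  have hCpos : 0 < C := add_pos_of_nonneg_of_pos (Finset.sum_nonneg fun _ _ => sq_nonneg _) hε
  have hCle : ∀ a : (ℕ → ℂ) → ℂ, ‖∑ z ∈ Y, a z • u z‖ ^ 2 ≤ C * ∑ z ∈ Y, ‖a z‖ ^ 2 := by
    intro a
    have h1 : ‖∑ z ∈ Y, a z • u z‖ ≤ ∑ z ∈ Y, ‖a z‖ * ‖u z‖ :=
      (norm_sum_le _ _).trans_eq (Finset.sum_congr rfl fun z _ => norm_smul _ _)
    have h2 := Finset.sum_mul_sq_le_sq_mul_sq Y (fun z => ‖a z‖) fun z => ‖u z‖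
    have h3 : 0 ≤ ∑ z ∈ Y, ‖a z‖ ^ 2 := Finset.sum_nonneg fun _ _ => sq_nonneg _
    calc ‖∑ z ∈ Y, a z • u z‖ ^ 2 ≤ (∑ z ∈ Y, ‖a z‖ * ‖u z‖) ^ 2 := by gcongr
      _ ≤ (∑ z ∈ Y, ‖a z‖ ^ 2) * ∑ z ∈ Y, ‖u z‖ ^ 2 := h2
      _ ≤ C * ∑ z ∈ Y, ‖a z‖ ^ 2 := by rw [hC]; nlinarith
  have hr2 : 0 < 1 - r ^ 2 := by nlinarith
  set κ : ℝ := ε * (1 - r ^ 2) / C with hκ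
  have hκpos : 0 < κ := by positivity
  have hκ1 : κ ≤ 1 := by
    rw [hκ, div_le_one hCpos]
    have : 0 ≤ ∑ z ∈ Y, ‖u z‖ ^ 2 := Finset.sum_nonneg fun _ _ => sq_nonneg _
    nlinarith [sq_nonneg r]
  have hθ1 : Real.sqrt (1 - κ) < 1 := by
    rw [Real.sqrt_lt' one_pos]; linarith
  obtain ⟨E, _, _, _, T, v, hcomm, hTn, hTv, hv⟩ := exists_commuting_contractions (N := N) Y u
    (Real.sqrt_nonneg (1 - κ)) (by
      intro j hj a
      refine le_of_sq_le_sq ?_ (mul_nonneg (Real.sqrt_nonneg _) (norm_nonneg _))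
      rw [mul_pow, Real.sq_sqrt (by linarith), hu fun z => a z * z j]
      have h1 := hLj j hj a
      have h2 : ∑ z ∈ Y, ‖a z * z j‖ ^ 2 ≤ r ^ 2 * ∑ z ∈ Y, ‖a z‖ ^ 2 := by
        rw [Finset.mul_sum]
        refine Finset.sum_le_sum fun z hz => ?_
        rw [norm_mul, mul_pow, mul_comm]
        gcongr
        exact hzr z hz j
      have h3 := hCle a
      have h4 := hu a
      have h5 : κ * ‖∑ z ∈ Y, a z • u z‖ ^ 2 ≤ ε * (1 - r ^ 2) * ∑ z ∈ Y, ‖a z‖ ^ 2 := by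
        rw [hκ, div_mul_eq_mul_div, div_le_iff₀ hCpos]
        have : 0 ≤ ε * (1 - r ^ 2) := by positivity
        nlinarith
      nlinarith)
  have hT1 : ∀ j, ‖T j‖ < 1 := fun j => (hTn j).trans_lt hθ1
  obtain ⟨c, hc⟩ := (hf N).1.exists_isPowerSeriesOf
  have hsum := hc.summable_norm_smul_opMonomial hT1
  have hS := hsum.of_norm.hasSum
  have hS1 := (hf N).2 E T hcomm hT1 _ ⟨c, hc, hsum, hS⟩
  set S := ∑' α, c α • opMonomial T α
  have hSv : ∀ z ∈ Y, S (v z) = f z • v z := by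
    intro z hz
    have := apply_eigenvector_of_hasSum hc hS (mem_polydisk_of_mem_ballLinfty (hY z hz))
      (fun j => hTv z hz j)
    rwa [restrictVars, extendByZero_eq (hN z hz)] at this
  have h1 : ‖∑ z ∈ Y, f z • v z‖ ≤ ‖∑ z ∈ Y, (1 : (ℕ → ℂ) → ℂ) z • v z‖ := by
    have h2 : S (∑ z ∈ Y, (1 : (ℕ → ℂ) → ℂ) z • v z) = ∑ z ∈ Y, f z • v z := by
      rw [map_sum]
      exact Finset.sum_congr rfl fun z hz => by simp [hSv z hz]
    rw [← h2]
    simpa using S.le_of_opNorm_le hS1 (∑ z ∈ Y, (1 : (ℕ → ℂ) → ℂ) z • v z)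
  rw [hv, hv] at h1
  have h3 := pow_le_pow_left₀ (norm_nonneg _) h1 2
  rw [hu, hu] at h3
  simp only [Pi.one_apply, norm_one, one_pow, Finset.sum_const, nsmul_eq_mul, mul_one] at h3
  have h4 : 0 ≤ ε * ∑ z ∈ Y, ‖f z‖ ^ 2 := by positivity
  linarith

lemma rankOne_apply {Y : Finset (ℕ → ℂ)} (a : (ℕ → ℂ) → ℂ) {z w : ℕ → ℂ} (hz : z ∈ Y)
    (hw : w ∈ Y) : rankOne Y a z w = a z * conj (a w) := by
  simp [rankOne, hz, hw]

/-- On a finite set of points, a function of the Agler class has Agler decompositions up to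
arbitrarily small errors: otherwise a functional separates `1 - f(z) conj f(w)` from the closed
convex cone of the kernels with a decomposition. -/
lemma AglerClassInfty.exists_approx_decomposition {f : (ℕ → ℂ) → ℂ} (hf : AglerClassInfty f)
    {Y : Finset (ℕ → ℂ)} (hY : ∀ z ∈ Y, z ∈ ballC00) {ε : ℝ} (hε : 0 < ε) :
    ∃ (N : ℕ) (K : ℕ → (ℕ → ℂ) → (ℕ → ℂ) → ℂ), (∀ j, PosSemidefOn Y (K j)) ∧
      (∀ j, N ≤ j → ∀ z w, K j z w = 0) ∧ ∀ z ∈ Y, ∀ w ∈ Y,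
        ‖1 - f z * conj (f w) -
          ∑ j ∈ Finset.range N, (1 - z j * conj (w j)) * K j z w‖ < ε := by
  classical
  have hYb : (Y : Set (ℕ → ℂ)) ⊆ ballLinfty := fun z hz => (hY z hz).1
  obtain ⟨N, hN0, hN⟩ : ∃ N : ℕ, 0 < N ∧ ∀ z ∈ Y, ∀ j, N ≤ j → z j = 0 := by
    have h2 := fun z hz => (hY z hz).2
    choose! M hM using h2
    refine ⟨Y.sup M + 1, Nat.succ_pos _, fun z hz j hj => hM z hz j ?_⟩
    exact (Finset.le_sup (f := M) hz).trans ((Nat.le_succ _).trans hj)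
  -- membership only constrains values on `Y`, so `S` is a cone in the space of all kernels
  let S : Set ((ℕ → ℂ) → (ℕ → ℂ) → ℂ) := {M | ∃ K : ℕ → (ℕ → ℂ) → (ℕ → ℂ) → ℂ,
    (∀ j, PosSemidefOn Y (K j)) ∧ ∀ z ∈ Y, ∀ w ∈ Y,
      M z w = ∑ j ∈ Finset.range N, (1 - z j * conj (w j)) * K j z w}
  let M₀ : (ℕ → ℂ) → (ℕ → ℂ) → ℂ := rankOne Y 1 - rankOne Y f
  have hM₀ : ∀ z ∈ Y, ∀ w ∈ Y, M₀ z w = 1 - f z * conj (f w) := fun z hz w hw => by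
    simp [M₀, rankOne_apply _ hz hw]
  have hSadd : ∀ M ∈ S, ∀ M' ∈ S, M + M' ∈ S := by
    rintro M ⟨K, hK, hM⟩ M' ⟨K', hK', hM'⟩
    refine ⟨fun j z w => K j z w + K' j z w, fun j => (hK j).add (hK' j), fun z hz w hw => ?_⟩
    simp only [Pi.add_apply, hM z hz w hw, hM' z hz w hw, mul_add, Finset.sum_add_distrib]
  have hSsmul : ∀ t : ℝ, 0 ≤ t → ∀ M ∈ S, t • M ∈ S := by
    rintro t ht M ⟨K, hK, hM⟩
    refine ⟨fun j z w => (Real.sqrt t : ℂ) * conj (Real.sqrt t : ℂ) * K j z w,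
      fun j => (hK j).mul_conj fun _ => (Real.sqrt t : ℂ), fun z hz w hw => ?_⟩
    have : (Real.sqrt t : ℂ) * conj (Real.sqrt t : ℂ) = t := by
      rw [Complex.conj_ofReal, ← Complex.ofReal_mul, Real.mul_self_sqrt ht]
    simp only [Pi.smul_apply, hM z hz w hw, this, Complex.real_smul, Finset.mul_sum]
    exact Finset.sum_congr rfl fun j _ => by ring
  by_cases hmem : M₀ ∈ closure S
  · have hopen : IsOpen {M : (ℕ → ℂ) → (ℕ → ℂ) → ℂ | ∀ z ∈ Y, ∀ w ∈ Y,
        ‖M₀ z w - M z w‖ < ε} := by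
      simp only [Set.ofPred_forall]
      refine isOpen_biInter_finset fun z _ => isOpen_biInter_finset fun w _ => ?_
      exact isOpen_lt (by fun_prop) continuous_const
    obtain ⟨M, hM1, K, hK, hM2⟩ := mem_closure_iff.1 hmem _ hopen (by simp [hε])
    refine ⟨N, fun j => if j < N then K j else 0, fun j => ?_, fun j hj z w => ?_,
      fun z hz w hw => ?_⟩
    · dsimp only
      split_ifs
      · exact hK j
      · exact posSemidefOn_zero
    · simp [not_lt.2 hj]
    · have := hM1 z hz w hw
      rw [hM₀ z hz w hw, hM2 z hz w hw] at this
      convert this using 3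
      exact Finset.sum_congr rfl fun j hj => by simp [Finset.mem_range.1 hj]
  · exfalso
    have hconv : Convex ℝ S := fun M hM M' hM' a b ha hb _ =>
      hSadd _ (hSsmul a ha M hM) _ (hSsmul b hb M' hM')
    obtain ⟨L, c, hLc, hcL⟩ :=
      geometric_hahn_banach_point_closed hconv.closure isClosed_closure hmem
    have hzero : (0 : (ℕ → ℂ) → (ℕ → ℂ) → ℂ) ∈ S :=
      ⟨fun _ _ _ => 0, fun _ => posSemidefOn_zero, fun _ _ _ _ => by simp⟩
    have hc0 : c < 0 := by simpa using hcL 0 (subset_closure hzero)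
    have hLS : ∀ M ∈ S, 0 ≤ L M := by
      intro M hM
      by_contra! hneg
      -- a large multiple of `M` would violate the lower bound `c`
      have h1 := hcL _
        (subset_closure (hSsmul (c / L M) (div_nonneg_of_nonpos hc0.le hneg.le) M hM))
      rw [map_smul, smul_eq_mul, div_mul_cancel₀ _ hneg.ne] at h1
      exact lt_irrefl _ h1
    -- rank one kernels are in the cone, by means of the first variable
    have hpos : ∀ a, 0 ≤ L (rankOne Y a) := by
      intro a
      refine hLS _ ⟨fun j z w => if j = 0 then (1 - z 0 * conj (w 0))⁻¹ * rankOne Y a z w else 0,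
        fun j => ?_, fun z hz w hw => ?_⟩
      · rcases eq_or_ne j 0 with rfl | hj
        · simpa using (posSemidefOn_rankOne _ Y a).div_szego hYb
        · simpa [hj] using posSemidefOn_zero
      · simp [hN0, one_sub_mul_conj_ne_zero (hYb hz) (hYb hw)]
    have hcontr : ∀ j < N, ∀ a, L (rankOne Y fun z => a z * z j) ≤ L (rankOne Y a) := by
      intro j hj a
      rw [← sub_nonneg, ← map_sub]
      refine hLS _ ⟨fun i => if i = j then rankOne Y a else 0, fun i => ?_, fun z hz w hw => ?_⟩
      · dsimp only
        split_ifs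
        · exact posSemidefOn_rankOne _ Y a
        · exact posSemidefOn_zero
      · rw [Finset.sum_eq_single j (fun i _ hij => by simp [hij])
          (fun h => (h (Finset.mem_range.2 hj)).elim)]
        simp only [Pi.sub_apply, rankOne_apply _ hz hw, if_true, map_mul]
        ring
    have := hf.functional_nonneg (fun z hz => (hY z hz).1) hN L.toLinearMap hpos hcontr
    have h2 : 0 ≤ L M₀ := by
      rw [map_sub]
      exact sub_nonneg.2 this
    linarith

end FiniteAgler

/-! ### Agler decompositions in infinitely many variables -/

section Limit

lemma exists_vanishing_bound {Y : Finset (ℕ → ℂ)} (hY : ∀ z ∈ Y, z ∈ ballC00) :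
    ∃ M : ℕ, ∀ z ∈ Y, ∀ j, M ≤ j → z j = 0 := by
  have h2 := fun z hz => (hY z hz).2
  choose! M hM using h2
  exact ⟨Y.sup M, fun z hz j hj => hM z hz j ((Finset.le_sup (f := M) hz).trans hj)⟩

/-- A function of the Agler class in infinitely many variables has an Agler decomposition. It is an
ultrafilter limit of approximate decompositions on finite sets. The mass of the kernels that moves
to infinitely large indices in the limit is a positive semi-definite remainder. -/
lemma AglerClassInfty.hasAglerDecomposition {f : (ℕ → ℂ) → ℂ} (hf : AglerClassInfty f) :
    HasAglerDecomposition ballC00 f := by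
  classical
  have hXb : ballC00 ⊆ ballLinfty := fun z hz => hz.1
  let Y : Finset ballC00 × ℕ → Finset (ℕ → ℂ) := fun i =>
    i.1.map (Function.Embedding.subtype _)
  let ε : Finset ballC00 × ℕ → ℝ := fun i => 1 / ((i.2 : ℝ) + 1)
  choose N K hK hK0 hKε using fun i : Finset ballC00 × ℕ =>
    hf.exists_approx_decomposition (Y := Y i) (fun z hz => by
      obtain ⟨w, -, rfl⟩ := Finset.mem_map.1 hz
      exact w.2) (ε := ε i) (by positivity)
  let 𝒰 : Ultrafilter (Finset ballC00 × ℕ) := Ultrafilter.of atTop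
  have h𝒰 : (𝒰 : Filter (Finset ballC00 × ℕ)) ≤ atTop := Ultrafilter.of_le _
  have hmem : ∀ z ∈ ballC00, ∀ᶠ i in 𝒰, z ∈ Y i := by
    intro z hz
    filter_upwards [h𝒰 (eventually_ge_atTop ({⟨z, hz⟩}, 0))] with i hi
    exact Finset.mem_map.2 ⟨⟨z, hz⟩, hi.1 (by simp), rfl⟩
  have hsub : ∀ Z : Finset (ℕ → ℂ), (∀ z ∈ Z, z ∈ ballC00) → ∀ᶠ i in 𝒰, Z ⊆ Y i := by
    intro Z hZ
    have := (Filter.eventually_all_finset Z).2 fun z hz => hmem z (hZ z hz)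
    filter_upwards [this] with i hi z hz
    exact hi z hz
  have hε : Tendsto ε 𝒰 (𝓝 0) := by
    have h1 : Tendsto (fun i : Finset ballC00 × ℕ => i.2) atTop atTop := by
      rw [← prod_atTop_atTop_eq]
      exact tendsto_snd
    exact (tendsto_one_div_add_atTop_nhds_zero_nat.comp h1).mono_left h𝒰
  -- the bound for the diagonal values, uniform along the ultrafilter
  have hdiag : ∀ z ∈ ballC00, ∃ C : ℝ, ∀ i, z ∈ Y i → ∀ s : Finset ℕ,
      ∑ j ∈ s, (K i j z z).re ≤ C := by
    intro z hz
    obtain ⟨r, hr, hzr⟩ := hz.1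
    have hr0 : 0 ≤ r := (norm_nonneg _).trans (hzr 0)
    have hr2 : 0 < 1 - r ^ 2 := by nlinarith
    refine ⟨2 / (1 - r ^ 2), fun i hi s => ?_⟩
    have hpos : ∀ j, 0 ≤ (K i j z z).re := fun j => ((hK i j).diag hi).1
    have h1 : ∑ j ∈ s, (K i j z z).re ≤ ∑ j ∈ Finset.range (N i), (K i j z z).re := by
      rw [← Finset.sum_filter_add_sum_filter_not s (fun j => j < N i)]
      rw [Finset.sum_eq_zero (s := s.filter fun j => ¬ j < N i) fun j hj => by
        rw [hK0 i j (not_lt.1 (Finset.mem_filter.1 hj).2), Complex.zero_re], add_zero]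
      refine Finset.sum_le_sum_of_subset_of_nonneg (fun j hj => ?_) fun j _ _ => hpos j
      exact Finset.mem_range.2 (Finset.mem_filter.1 hj).2
    have h2 := (Complex.abs_re_le_norm _).trans (hKε i z hi z hi).le
    have hεi : ε i ≤ 1 := by
      simp only [ε]
      rw [div_le_one (by positivity)]
      linarith [Nat.cast_nonneg (α := ℝ) i.2]
    have h3 := (abs_le.1 (h2.trans hεi)).1
    have h4 : (∑ j ∈ Finset.range (N i), (1 - z j * conj (z j)) * K i j z z).re =
        ∑ j ∈ Finset.range (N i), (1 - ‖z j‖ ^ 2) * (K i j z z).re := by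
      rw [Complex.re_sum]
      refine Finset.sum_congr rfl fun j _ => ?_
      rw [Complex.mul_conj, Complex.normSq_eq_norm_sq, ← Complex.ofReal_one, ← Complex.ofReal_sub,
        Complex.re_ofReal_mul]
    rw [Complex.sub_re, Complex.sub_re, h4, Complex.mul_conj, Complex.ofReal_re, Complex.one_re]
      at h3
    have h5 : (1 - r ^ 2) * ∑ j ∈ Finset.range (N i), (K i j z z).re ≤
        ∑ j ∈ Finset.range (N i), (1 - ‖z j‖ ^ 2) * (K i j z z).re := by
      rw [Finset.mul_sum]
      refine Finset.sum_le_sum fun j _ => mul_le_mul_of_nonneg_right ?_ (hpos j)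
      have := pow_le_pow_left₀ (norm_nonneg _) (hzr j) 2
      linarith
    refine h1.trans ?_
    rw [le_div_iff₀ hr2, mul_comm]
    linarith [Complex.normSq_nonneg (f z)]
  choose! C hC using hdiag
  have hlim : ∀ j z w, ∃ κ : ℂ, z ∈ ballC00 → w ∈ ballC00 →
      Tendsto (fun i => K i j z w) 𝒰 (𝓝 κ) := by
    intro j z w
    by_cases hz : z ∈ ballC00
    swap
    · exact ⟨0, fun h => (hz h).elim⟩
    by_cases hw : w ∈ ballC00
    swap
    · exact ⟨0, fun _ h => (hw h).elim⟩
    have hev : ∀ᶠ i in 𝒰, K i j z w ∈ Metric.closedBall (0 : ℂ) (C z + C w) := by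
      filter_upwards [hmem z hz, hmem w hw] with i hzi hwi
      rw [mem_closedBall_zero_iff]
      refine ((hK i j).norm_le hzi hwi).trans (add_le_add ?_ ?_)
      · simpa using hC z hz i hzi {j}
      · simpa using hC w hw i hwi {j}
    obtain ⟨κ, -, hκ⟩ := (isCompact_closedBall (0 : ℂ) (C z + C w)).ultrafilter_le_nhds'
      (𝒰.map fun i => K i j z w) hev
    exact ⟨κ, fun _ _ => hκ⟩
  choose κ hκ using hlim
  have hκpsd : ∀ j, PosSemidefOn ballC00 (κ j) := fun j =>
    posSemidefOn_of_tendsto (l := (𝒰 : Filter _)) (K' := fun i => K i j) (fun Z hZ => by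
      filter_upwards [hsub Z hZ] with i hi
      exact (hK i j).mono fun z hz => hi hz) fun z hz w hw => hκ j z w hz hw
  have hκdiag : ∀ z ∈ ballC00, Summable fun j => (κ j z z).re := by
    intro z hz
    refine summable_of_sum_le (c := C z) (fun j => ((hκpsd j).diag hz).1) fun s => ?_
    have ht : Tendsto (fun i => ∑ j ∈ s, (K i j z z).re) 𝒰 (𝓝 (∑ j ∈ s, (κ j z z).re)) :=
      tendsto_finsetSum _ fun j _ => (Complex.continuous_re.tendsto _).comp (hκ j z z hz hz)
    refine le_of_tendsto ht ?_
    filter_upwards [hmem z hz] with i hi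
    exact hC z hz i hi s
  have hκsum : ∀ z ∈ ballC00, ∀ w ∈ ballC00,
      Summable fun j => (1 - z j * conj (w j)) * κ j z w := by
    intro z hz w hw
    refine Summable.of_norm_bounded (((hκdiag z hz).add (hκdiag w hw)).mul_left 2) fun j => ?_
    rw [norm_mul]
    refine mul_le_mul ?_ ((hκpsd j).norm_le hz hw) (norm_nonneg _) zero_le_two
    refine (norm_sub_le _ _).trans ?_
    rw [norm_one]
    linarith [norm_mul_conj_lt_one hz.1 hw.1 j]
  have hR : PosSemidefOn ballC00 fun z w =>
      1 - f z * conj (f w) - ∑' j, (1 - z j * conj (w j)) * κ j z w := by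
    refine posSemidefOn_of_tendsto (l := atTop) (K' := fun M z w =>
      1 - f z * conj (f w) - ∑ j ∈ Finset.range M, (1 - z j * conj (w j)) * κ j z w)
      (fun Z hZ => ?_) fun z hz w hw =>
        (hκsum z hz w hw).hasSum.tendsto_sum_nat.const_sub _
    obtain ⟨M₀, hM₀⟩ := exists_vanishing_bound hZ
    filter_upwards [eventually_ge_atTop M₀] with M hM
    -- the kernels of index at least `M` enter with the factor one on `Z`
    refine posSemidefOn_of_tendsto (l := (𝒰 : Filter _))
      (K' := fun i z w => ∑ j ∈ Finset.Ico M (max M (N i)), K i j z w)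
      (fun Z' hZ' => ?_) fun z hz w hw => ?_
    · filter_upwards [hsub Z' fun z hz => hZ z (hZ' z hz)] with i hi
      exact PosSemidefOn.sum _ fun j _ => (hK i j).mono fun z hz => hi hz
    · have hz' := hZ z hz
      have hw' := hZ w hw
      have ht1 : Tendsto (fun i => 1 - f z * conj (f w) -
          ∑ j ∈ Finset.range M, (1 - z j * conj (w j)) * K i j z w) 𝒰
          (𝓝 (1 - f z * conj (f w) -
            ∑ j ∈ Finset.range M, (1 - z j * conj (w j)) * κ j z w)) :=
        (tendsto_finsetSum _ fun j _ => (hκ j z w hz' hw').const_mul _).const_sub _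
      have ht2 : Tendsto (fun i => 1 - f z * conj (f w) -
          ∑ j ∈ Finset.range (N i), (1 - z j * conj (w j)) * K i j z w) 𝒰 (𝓝 0) := by
        refine squeeze_zero_norm' ?_ hε
        filter_upwards [hmem z hz', hmem w hw'] with i hzi hwi
        exact (hKε i z hzi w hwi).le
      have ht3 := ht1.sub ht2
      rw [sub_zero] at ht3
      refine ht3.congr fun i => ?_
      have h1 : ∑ j ∈ Finset.range (N i), (1 - z j * conj (w j)) * K i j z w =
          ∑ j ∈ Finset.range (max M (N i)), (1 - z j * conj (w j)) * K i j z w := by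
        refine Finset.sum_subset (Finset.range_subset_range.2 (le_max_right _ _)) fun j _ hj => ?_
        rw [hK0 i j (by simpa using hj), mul_zero]
      have h2 : ∑ j ∈ Finset.Ico M (max M (N i)), K i j z w =
          ∑ j ∈ Finset.Ico M (max M (N i)), (1 - z j * conj (w j)) * K i j z w := by
        refine Finset.sum_congr rfl fun j hj => ?_
        rw [hM₀ z hz j (hM.trans (Finset.mem_Ico.1 hj).1), zero_mul, sub_zero, one_mul]
      rw [h1, h2, ← Finset.sum_range_add_sum_Ico _ (le_max_left M (N i))]
      ring
  refine hasAglerDecomposition_of_remainder hXb hκpsd hR fun z hz w hw => ?_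
  rw [sub_sub_cancel]
  exact (hκsum z hz w hw).hasSum

end Limit

/-! ### The transfer function on the ball of bounded sequences -/

section TransferFunction

variable {H : ℕ → Type*} [∀ j, NormedAddCommGroup (H j)] [∀ j, InnerProductSpace ℂ (H j)]
  {V : StateSpace H →L[ℂ] StateSpace H}

/-- The transfer operator of the blocks of `V` with the block diagonal operator `Δ`. -/
def scalarTransfer (V : StateSpace H →L[ℂ] StateSpace H)
    (Δ : HilbertSum H →L[ℂ] HilbertSum H) : ℂ →L[ℂ] ℂ :=
  transferOp (blockA V) (blockB V) (blockC V) (blockD V) Δ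

lemma IsTransferValue.unique {z : ℕ → ℂ} {w w' : ℂ} (h : IsTransferValue V z w)
    (h' : IsTransferValue V z w') : w = w' := by
  obtain ⟨Δ, hΔ, -, rfl⟩ := h
  obtain ⟨Δ', hΔ', -, rfl⟩ := h'
  rw [hΔ.unique hΔ']

lemma IsTransferValue.eq_scalarTransfer {z : ℕ → ℂ} {w : ℂ} (h : IsTransferValue V z w)
    {Δ : HilbertSum H →L[ℂ] HilbertSum H} (hΔ : IsStrongSum (fun j => z j • proj H j) Δ) :
    w = scalarTransfer V Δ 1 := by
  obtain ⟨Δ', hΔ', -, rfl⟩ := h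
  rw [hΔ.unique hΔ']
  rfl

variable [∀ j, CompleteSpace (H j)]

lemma isTransferValue_scalarTransfer (hV : ‖V‖ ≤ 1) {z : ℕ → ℂ}
    {Δ : HilbertSum H →L[ℂ] HilbertSum H} (hΔ : IsStrongSum (fun j => z j • proj H j) Δ) {r : ℝ}
    (hr : r < 1) (h : ‖Δ‖ ≤ r) : IsTransferValue V z (scalarTransfer V Δ 1) :=
  ⟨Δ, hΔ, isUnit_one_sub_comp (norm_blockD_le hV) h hr, rfl⟩

lemma exists_isTransferValue (hV : ‖V‖ ≤ 1) {z : ℕ → ℂ} (hz : z ∈ ballLinfty) :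
    ∃ w, IsTransferValue V z w := by
  obtain ⟨r, hr, hzr⟩ := hz
  obtain ⟨Δ, hΔ, hn⟩ := exists_diagonal (H := H) hzr
  exact ⟨_, isTransferValue_scalarTransfer hV hΔ hr hn⟩

lemma IsTransferValue.norm_le (hV : ‖V‖ ≤ 1) {z : ℕ → ℂ} (hz : z ∈ ballLinfty) {w : ℂ}
    (h : IsTransferValue V z w) : ‖w‖ ≤ 1 := by
  obtain ⟨r, hr, hzr⟩ := hz
  obtain ⟨Δ, hΔ, hn⟩ := exists_diagonal (H := H) hzr
  rw [h.eq_scalarTransfer hΔ]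
  have h1 : ‖scalarTransfer V Δ‖ ≤ 1 := norm_transferOp_le (block_norm_sq_le hV)
    (hn.trans hr.le) (isUnit_one_sub_comp (norm_blockD_le hV) hn hr)
  refine ((scalarTransfer V Δ).le_of_opNorm_le h1 1).trans_eq ?_
  rw [norm_one, one_mul]

lemma truncate_mem_ballC00 {z : ℕ → ℂ} (hz : z ∈ ballLinfty) (N : ℕ) :
    truncate N z ∈ ballC00 := by
  obtain ⟨r, hr, hzr⟩ := hz
  refine ⟨⟨r, hr, fun j => ?_⟩, N, fun j hj => by simp [truncate, not_lt.2 hj]⟩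
  simp only [truncate]
  split_ifs
  · exact hzr j
  · simpa using (norm_nonneg _).trans (hzr j)

lemma isStrongSum_of_vanishing {E : Type*} [NormedAddCommGroup E] [InnerProductSpace ℂ E]
    {A A' : ℕ → E →L[ℂ] E} {N : ℕ} (h : ∀ j < N, A' j = A j) (h' : ∀ j, N ≤ j → A' j = 0) :
    IsStrongSum A' (∑ j ∈ Finset.range N, A j) := by
  rw [← Finset.sum_congr rfl fun j hj => h j (Finset.mem_range.1 hj)]
  exact isStrongSum_of_finite h'

lemma tendsto_transferValue_truncate (hV : ‖V‖ ≤ 1) {F : (ℕ → ℂ) → ℂ}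
    (hF : ∀ z ∈ ballLinfty, IsTransferValue V z (F z)) {z : ℕ → ℂ} (hz : z ∈ ballLinfty) :
    Tendsto (fun N => F (truncate N z)) atTop (𝓝 (F z)) := by
  have hF' := fun N => hF _ (truncate_mem_ballC00 hz N).1
  have hFz := hF z hz
  obtain ⟨r, hr, hzr⟩ := hz
  obtain ⟨Δ, hΔ, hn⟩ := exists_diagonal (H := H) hzr
  rw [hFz.eq_scalarTransfer hΔ]
  have hN : ∀ N, F (truncate N z) =
      scalarTransfer V (∑ j ∈ Finset.range N, z j • proj H j) 1 := fun N =>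
    (hF' N).eq_scalarTransfer (isStrongSum_of_vanishing
      (fun j hj => by simp [truncate, hj]) fun j hj => by simp [truncate, not_lt.2 hj])
  simp only [hN]
  exact tendsto_transferOp_apply (norm_blockD_le hV) hr
    (fun N => (isBlockDiagonal_proj hzr).norm_sum_range_le N) hn hΔ.tendsto 1

/-- The diagonal operator depends linearly and continuously on its bounded symbol. -/
lemma exists_diagonal_clm (H : ℕ → Type*) [∀ j, NormedAddCommGroup (H j)]
    [∀ j, InnerProductSpace ℂ (H j)] [∀ j, CompleteSpace (H j)] :
    ∃ Φ : lp (fun _ : ℕ => ℂ) ∞ →L[ℂ] (HilbertSum H →L[ℂ] HilbertSum H),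
      ∀ z, IsStrongSum (fun j => z j • proj H j) (Φ z) ∧ ‖Φ z‖ ≤ ‖z‖ := by
  choose Φ hΦ hn using fun z : lp (fun _ : ℕ => ℂ) ∞ =>
    exists_diagonal (H := H) (z := z) (r := ‖z‖) fun j => lp.norm_apply_le_norm (by simp) z j
  let L : lp (fun _ : ℕ => ℂ) ∞ →ₗ[ℂ] (HilbertSum H →L[ℂ] HilbertSum H) :=
    { toFun := Φ
      map_add' := fun z w => (hΦ (z + w)).unique fun x => by
        refine ((hΦ z x).add (hΦ w x)).congr_fun fun j => ?_
        simp [add_smul]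
      map_smul' := fun c z => (hΦ (c • z)).unique fun x => by
        refine ((hΦ z x).const_smul c).congr_fun fun j => ?_
        simp [mul_smul] }
  exact ⟨L.mkContinuous 1 fun z => (hn z).trans_eq (one_mul _).symm, fun z => ⟨hΦ z, hn z⟩⟩

lemma differentiableOn_transferValue (hV : ‖V‖ ≤ 1) {F : (ℕ → ℂ) → ℂ}
    (hF : ∀ z ∈ ballLinfty, IsTransferValue V z (F z)) :
    DifferentiableOn ℂ (fun z : lp (fun _ : ℕ => ℂ) ∞ => F z) (Metric.ball 0 1) := by
  obtain ⟨Φ, hΦ⟩ := exists_diagonal_clm H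
  have hball : ∀ z ∈ Metric.ball (0 : lp (fun _ : ℕ => ℂ) ∞) 1, ‖z‖ < 1 := fun z hz => by
    simpa using hz
  have heq : ∀ z ∈ Metric.ball (0 : lp (fun _ : ℕ => ℂ) ∞) 1,
      F z = scalarTransfer V (Φ z) 1 := fun z hz =>
    (hF z ⟨‖z‖, hball z hz, fun j => lp.norm_apply_le_norm (by simp) z j⟩).eq_scalarTransfer
      (hΦ z).1
  refine DifferentiableOn.congr (fun z hz => DifferentiableAt.differentiableWithinAt ?_) heq
  have hu : IsUnit (1 - blockD V ∘L Φ z) :=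
    isUnit_one_sub_comp (norm_blockD_le hV) (hΦ z).2 (hball z hz)
  have h1 : DifferentiableAt ℂ (fun z => 1 - blockD V ∘L Φ z) z :=
    ((ContinuousLinearMap.compL ℂ _ _ _ (blockD V) ∘L Φ).differentiableAt).const_sub 1
  have h2 : DifferentiableAt ℂ (fun z => Ring.inverse (1 - blockD V ∘L Φ z)) z :=
    h1.inverse hu
  have h3 : DifferentiableAt ℂ
      (fun z => Φ z (Ring.inverse (1 - blockD V ∘L Φ z) (blockC V 1))) z :=
    Φ.differentiableAt.clm_apply (h2.clm_apply (differentiableAt_const _))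
  exact ((blockB V).differentiableAt.comp z h3).const_add (blockA V 1)

end TransferFunction

/-! ### Taylor coefficients of transfer functions -/

section Coefficients

variable {N : ℕ}

/-- The family `w` of coefficients after multiplication of the power series by the variable `j`. -/
def shiftCoeff {M : Type*} [Zero M] (j : Fin N) (w : (Fin N → ℕ) → M) (α : Fin N → ℕ) : M :=
  if α j = 0 then 0 else w (α - Pi.single j 1)

lemma sub_single_add_single {j : Fin N} {α : Fin N → ℕ} (h : α j ≠ 0) :
    α - Pi.single j 1 + Pi.single j 1 = α := by
  ext i
  rcases eq_or_ne i j with rfl | hi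
  · simp; omega
  · simp [hi]

lemma hasSum_shiftCoeff {M : Type*} [AddCommMonoid M] [TopologicalSpace M] (j : Fin N)
    {w : (Fin N → ℕ) → M} {s : M} : HasSum (shiftCoeff j w) s ↔ HasSum w s := by
  have hinj : Function.Injective fun α : Fin N → ℕ => α + Pi.single j 1 :=
    add_left_injective _
  rw [← hinj.hasSum_iff]
  · have : shiftCoeff j w ∘ (fun α : Fin N → ℕ => α + Pi.single j 1) = w := by
      ext α; simp [shiftCoeff]
    rw [this]
  · intro α hα
    simp only [shiftCoeff]
    rw [if_pos]
    by_contra h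
    exact hα ⟨_, sub_single_add_single h⟩

lemma tsum_shiftCoeff (j : Fin N) (w : (Fin N → ℕ) → ℝ≥0∞) :
    ∑' α, shiftCoeff j w α = ∑' α, w α :=
  ((hasSum_shiftCoeff j).2 ENNReal.summable.hasSum).tsum_eq

variable {H : ℕ → Type*} [∀ j, NormedAddCommGroup (H j)] [∀ j, InnerProductSpace ℂ (H j)]

lemma norm_sq_sum_proj (x : Fin N → HilbertSum H) :
    ‖∑ j : Fin N, proj H j (x j)‖ ^ 2 = ∑ j : Fin N, ‖proj H j (x j)‖ ^ 2 := by
  have hb := isBlockDiagonal_proj (H := H) (z := 0) (r := 0) (by simp)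
  have := hb.norm_sq_sum (Finset.range N)
    (f := fun j => proj H j (if h : j < N then x ⟨j, h⟩ else 0)) fun j => hb.idem j _
  rw [Finset.sum_range, Finset.sum_range] at this
  simpa using this

lemma sum_norm_sq_proj_le (x : HilbertSum H) : ∑ j : Fin N, ‖proj H j x‖ ^ 2 ≤ ‖x‖ ^ 2 := by
  have hb := isBlockDiagonal_proj (H := H) (z := 0) (r := 0) (by simp)
  have := hb.sum_norm_sq_le (Finset.range N) x
  rwa [Finset.sum_range] at this

/-- The sum of the coefficients `P_j w_(α - e_j)`, that is, the coefficients of `Δ(z) w(z)`. -/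
def deltaCoeff (w : (Fin N → ℕ) → HilbertSum H) (α : Fin N → ℕ) : HilbertSum H :=
  ∑ j : Fin N, proj H j (shiftCoeff j w α)

/-- The coefficients of `(D Δ(z)) ^ n c`. -/
def layerCoeff (D : HilbertSum H →L[ℂ] HilbertSum H) (c : HilbertSum H) :
    ℕ → (Fin N → ℕ) → HilbertSum H
  | 0 => Pi.single 0 c
  | n + 1 => fun α => D (deltaCoeff (layerCoeff D c n) α)

/-- The coefficients of `(1 - D Δ(z))⁻¹ c`. The part of degree `n` is that of `(D Δ(z)) ^ n c`. -/
def stateCoeff (D : HilbertSum H →L[ℂ] HilbertSum H) (c : HilbertSum H) (α : Fin N → ℕ) :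
    HilbertSum H :=
  layerCoeff D c (∑ j, α j) α

/-- The coefficients of `a + B Δ(z) (1 - D Δ(z))⁻¹ c`. -/
def transferCoeff (a : ℂ) (B : HilbertSum H →L[ℂ] ℂ) (D : HilbertSum H →L[ℂ] HilbertSum H)
    (c : HilbertSum H) (α : Fin N → ℕ) : ℂ :=
  (if α = 0 then a else 0) + B (deltaCoeff (stateCoeff D c) α)

variable {D : HilbertSum H →L[ℂ] HilbertSum H} {c : HilbertSum H}

/-- Multiplication by `Δ(z)` does not increase the `ℓ²` norm of the coefficients: the projections
`P_j` are mutually orthogonal and the shifts are injective. -/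
lemma tsum_enorm_deltaCoeff_le (w : (Fin N → ℕ) → HilbertSum H) :
    ∑' α, ‖deltaCoeff w α‖ₑ ^ 2 ≤ ∑' α, ‖w α‖ₑ ^ 2 := by
  have hsq : ∀ x : HilbertSum H, ‖x‖ₑ ^ 2 = ENNReal.ofReal (‖x‖ ^ 2) := fun x => by
    rw [ENNReal.ofReal_pow (norm_nonneg _), ofReal_norm]
  calc ∑' α, ‖deltaCoeff w α‖ₑ ^ 2
      = ∑' α, ∑' j : Fin N, shiftCoeff j (fun β => ‖proj H j (w β)‖ₑ ^ 2) α := by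
        refine tsum_congr fun α => ?_
        rw [deltaCoeff, hsq, norm_sq_sum_proj,
          ENNReal.ofReal_sum_of_nonneg fun _ _ => sq_nonneg _, tsum_fintype]
        refine Finset.sum_congr rfl fun j _ => ?_
        rw [← hsq]
        simp only [shiftCoeff]
        split_ifs <;> simp
    _ = ∑' j : Fin N, ∑' α, ‖proj H j (w α)‖ₑ ^ 2 := by
        rw [ENNReal.tsum_comm]
        exact tsum_congr fun j => tsum_shiftCoeff j _
    _ = ∑' α, ∑' j : Fin N, ‖proj H j (w α)‖ₑ ^ 2 := ENNReal.tsum_comm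
    _ ≤ ∑' α, ‖w α‖ₑ ^ 2 := by
        refine ENNReal.tsum_le_tsum fun α => ?_
        rw [tsum_fintype]
        simp only [hsq]
        rw [← ENNReal.ofReal_sum_of_nonneg fun _ _ => sq_nonneg _]
        exact ENNReal.ofReal_le_ofReal (sum_norm_sq_proj_le _)

lemma tsum_enorm_layerCoeff_le (hD : ‖D‖ ≤ 1) (hc : ‖c‖ ≤ 1) (n : ℕ) :
    ∑' α : Fin N → ℕ, ‖layerCoeff D c n α‖ₑ ^ 2 ≤ 1 := by
  classical
  induction n with
  | zero =>
    rw [tsum_eq_single 0 fun α hα => by simp [layerCoeff, hα]]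
    simp only [layerCoeff, Pi.single_eq_same]
    refine pow_le_one₀ zero_le ?_
    rw [← ofReal_norm]
    exact ENNReal.ofReal_le_one.2 hc
  | succ n ih =>
    refine le_trans (ENNReal.tsum_le_tsum fun α => ?_) ((tsum_enorm_deltaCoeff_le _).trans ih)
    simp only [layerCoeff]
    gcongr
    rw [← ofReal_norm, ← ofReal_norm]
    refine ENNReal.ofReal_le_ofReal ?_
    simpa using D.le_of_opNorm_le hD (deltaCoeff (layerCoeff D c n) α)

lemma norm_stateCoeff_le (hD : ‖D‖ ≤ 1) (hc : ‖c‖ ≤ 1) (α : Fin N → ℕ) :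
    ‖stateCoeff D c α‖ ≤ 1 := by
  have h1 : ‖stateCoeff D c α‖ₑ ^ 2 ≤ 1 :=
    (ENNReal.le_tsum (f := fun β : Fin N → ℕ => ‖layerCoeff D c (∑ j, α j) β‖ₑ ^ 2) α).trans
      (tsum_enorm_layerCoeff_le hD hc _)
  rw [← ofReal_norm, ← ENNReal.ofReal_pow (norm_nonneg _), ENNReal.ofReal_le_one] at h1
  exact le_of_sq_le_sq (by simpa using h1) zero_le_one

/-- The coefficientwise form of `u(z) = c + D Δ(z) u(z)`. -/
lemma stateCoeff_eq (D : HilbertSum H →L[ℂ] HilbertSum H) (c : HilbertSum H) (α : Fin N → ℕ) :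
    stateCoeff D c α = (if α = 0 then c else 0) + D (deltaCoeff (stateCoeff D c) α) := by
  rcases eq_or_ne α 0 with rfl | hα
  · simp [stateCoeff, layerCoeff, deltaCoeff, shiftCoeff]
  · obtain ⟨n, hn⟩ : ∃ n, ∑ j, α j = n + 1 := by
      refine Nat.exists_eq_succ_of_ne_zero fun h0 => hα ?_
      ext j
      exact (Finset.sum_eq_zero_iff.1 h0) j (Finset.mem_univ j)
    rw [if_neg hα, zero_add, stateCoeff, hn]
    simp only [layerCoeff, deltaCoeff]
    congr 1
    refine Finset.sum_congr rfl fun j _ => ?_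
    congr 1
    simp only [shiftCoeff]
    split_ifs with h
    · rfl
    · have h1 : ∑ i, (α - Pi.single j 1 : Fin N → ℕ) i = n := by
        have h2 := congrArg (fun β : Fin N → ℕ => ∑ i, β i) (sub_single_add_single h)
        simp only [Pi.add_apply, Finset.sum_add_distrib, Finset.sum_pi_single',
          Finset.mem_univ, if_true] at h2
        simp only [Pi.sub_apply] at h2 ⊢
        omega
      rw [stateCoeff, h1]

/-- Summation of the Taylor coefficients of `(1 - D Δ(z))⁻¹ c` against operator monomials. The
bilinear map `β` stands both for scalar multiplication and for the Hilbert space tensor product;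
`D'`, `Δ'` and `B'` are the corresponding amplifications. -/
lemma exists_state_vector {E L : Type*} [NormedAddCommGroup E] [InnerProductSpace ℂ E]
    [CompleteSpace E] [NormedAddCommGroup L] [NormedSpace ℂ L] [CompleteSpace L]
    (hD : ‖D‖ ≤ 1) (hc : ‖c‖ ≤ 1) (B : HilbertSum H →L[ℂ] ℂ) (a : ℂ)
    (β : HilbertSum H →L[ℂ] E →L[ℂ] L) {T : Fin N → E →L[ℂ] E}
    (hT : ∀ i j, Commute (T i) (T j)) (hT1 : ∀ j, ‖T j‖ < 1)
    {D' Δ' : L →L[ℂ] L} {B' : L →L[ℂ] E}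
    (hD' : ∀ k x, D' (β k x) = β (D k) x) (hB' : ∀ k x, B' (β k x) = B k • x)
    (hΔ' : ∀ k x, Δ' (β k x) = ∑ j : Fin N, β (proj H j k) (T j x)) (x : E) :
    ∃ ξ : L, ξ - D' (Δ' ξ) = β c x ∧
      HasSum (fun α => transferCoeff a B D c α • opMonomial T α x) (a • x + B' (Δ' ξ)) := by
  have hgeom := summable_prod_pow (fun j => norm_nonneg (T j)) hT1
  have hβ : ∀ (k : HilbertSum H) (y : E), ‖k‖ ≤ 1 → ‖β k y‖ ≤ ‖β‖ * ‖y‖ := fun k y hk => by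
    refine (β.le_opNorm₂ k y).trans ?_
    gcongr
    nlinarith [norm_nonneg β, norm_nonneg k]
  have hmon : ∀ α, ‖opMonomial T α x‖ ≤ (∏ j, ‖T j‖ ^ α j) * ‖x‖ := fun α =>
    (opMonomial T α).le_of_opNorm_le (norm_opMonomial_le T α) x
  have hsum : Summable fun α => β (stateCoeff D c α) (opMonomial T α x) := by
    refine Summable.of_norm_bounded ((hgeom.mul_right ‖x‖).mul_left ‖β‖) fun α => ?_
    refine (hβ _ _ (norm_stateCoeff_le hD hc α)).trans ?_
    gcongr
    exact hmon α
  have hsumj : ∀ j : Fin N, Summable fun α : Fin N → ℕ =>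
      β (proj H j (stateCoeff D c α)) (opMonomial T (α + Pi.single j 1) x) := by
    intro j
    refine Summable.of_norm_bounded (((hgeom.mul_right ‖x‖).mul_left ‖T j‖).mul_left ‖β‖)
      fun α => ?_
    refine (hβ _ _ ?_).trans ?_
    · refine ((proj H j).le_of_opNorm_le (norm_proj_le j) _).trans ?_
      rw [one_mul]
      exact norm_stateCoeff_le hD hc α
    · rw [← mul_opMonomial hT, mul_apply_eq_comp]
      gcongr
      exact ((T j).le_opNorm _).trans (by gcongr; exact hmon α)
  -- `ξ` plays the role of `(1 - D Δ)⁻¹ C x`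
  let ξ : L := ∑' α, β (stateCoeff D c α) (opMonomial T α x)
  have hξ : HasSum (fun α => β (stateCoeff D c α) (opMonomial T α x)) ξ := hsum.hasSum
  have hΔξ : HasSum (fun α => β (deltaCoeff (stateCoeff D c) α) (opMonomial T α x)) (Δ' ξ) := by
    have h1 := hasSum_sum fun (j : Fin N) (_ : j ∈ Finset.univ) =>
      (hasSum_shiftCoeff j).2 (hsumj j).hasSum
    have h2 := hasSum_sum fun (j : Fin N) (_ : j ∈ Finset.univ) => (hsumj j).hasSum
    have h3 : HasSum (fun α : Fin N → ℕ => ∑ j : Fin N,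
        β (proj H j (stateCoeff D c α)) (opMonomial T (α + Pi.single j 1) x)) (Δ' ξ) := by
      refine (hξ.mapL Δ').congr_fun fun α => ?_
      rw [hΔ']
      exact Finset.sum_congr rfl fun j _ => by rw [← mul_opMonomial hT, mul_apply_eq_comp]
    rw [← h3.unique h2] at h1
    refine h1.congr_fun fun α => ?_
    rw [deltaCoeff, map_sum, _root_.sum_apply]
    refine Finset.sum_congr rfl fun j _ => ?_
    simp only [shiftCoeff]
    split_ifs with h
    · simp
    · rw [sub_single_add_single h]
  refine ⟨ξ, ?_, ?_⟩
  · have h1 := (hΔξ.mapL D').add (hasSum_ite_eq (0 : Fin N → ℕ) (β c x))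
    have h2 := hξ.unique (h1.congr_fun fun α => by
      rw [hD', stateCoeff_eq D c α, map_add, _root_.add_apply, add_comm]
      congr 1
      split_ifs with h
      · subst h; simp [opMonomial_zero]
      · simp)
    exact sub_eq_of_eq_add' h2
  · have h1 := (hasSum_ite_eq (0 : Fin N → ℕ) (a • x)).add (hΔξ.mapL B')
    refine h1.congr_fun fun α => ?_
    rw [hB', transferCoeff, add_smul]
    congr 1
    split_ifs with h
    · subst h; simp [opMonomial_zero]
    · simp

end Coefficients

variable {H : ℕ → Type*} [∀ j, NormedAddCommGroup (H j)] [∀ j, InnerProductSpace ℂ (H j)]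
  {V : StateSpace H →L[ℂ] StateSpace H}

lemma extendByZero_mem_ballC00 {N : ℕ} {z : Fin N → ℂ} (hz : z ∈ polydisk N) :
    extendByZero z ∈ ballC00 := by
  refine ⟨?_, N, fun j hj => by simp [extendByZero, not_lt.2 hj]⟩
  obtain ⟨r, hr0, hr, hzr⟩ : ∃ r : ℝ, 0 ≤ r ∧ r < 1 ∧ ∀ j, ‖z j‖ ≤ r := by
    rcases isEmpty_or_nonempty (Fin N) with h | h
    · exact ⟨0, le_rfl, one_pos, fun j => h.elim j⟩
    · obtain ⟨i, hi⟩ := Finite.exists_max fun j => ‖z j‖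
      exact ⟨‖z i‖, norm_nonneg _, hz i, hi⟩
  refine ⟨r, hr, fun j => ?_⟩
  simp only [extendByZero]
  split_ifs with h
  · exact hzr _
  · simpa using hr0

/-- The case of `exists_state_vector` in which the operators are numbers. -/
lemma isPowerSeriesOf_transferCoeff [∀ j, CompleteSpace (H j)] (hV : ‖V‖ ≤ 1)
    {f : (ℕ → ℂ) → ℂ} (hf : ∀ z ∈ ballC00, IsTransferValue V z (f z)) (N : ℕ) :
    IsPowerSeriesOf (transferCoeff (blockA V 1) (blockB V) (blockD V) (blockC V 1))
      (restrictVars f N) := by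
  intro z hz
  have hfz := hf _ (extendByZero_mem_ballC00 hz)
  have hΔ : IsStrongSum (fun j => extendByZero z j • proj H j)
      (∑ j ∈ Finset.range N, extendByZero z j • proj H j) :=
    isStrongSum_of_finite fun j hj => by simp [extendByZero, not_lt.2 hj]
  obtain ⟨r, hr, hzr⟩ := (extendByZero_mem_ballC00 hz).1
  have hu : IsUnit (1 - blockD V ∘L ∑ j ∈ Finset.range N, extendByZero z j • proj H j) :=
    isUnit_one_sub_comp (norm_blockD_le hV)
      ((isBlockDiagonal_proj hzr).norm_sum_range_le N) hr
  let T : Fin N → ℂ →L[ℂ] ℂ := fun j => z j • 1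
  have hT : ∀ j, ‖T j‖ < 1 := fun j =>
    (ContinuousLinearMap.opNorm_le_bound _ (norm_nonneg (z j)) fun x => by simp [T]).trans_lt (hz j)
  obtain ⟨ξ, hξ, hsum⟩ := exists_state_vector (norm_blockD_le hV) (norm_blockC_one_le hV)
    (blockB V) (blockA V 1) (ContinuousLinearMap.lsmul ℂ ℂ (E := HilbertSum H)).flip
    (T := T) (fun i j => by ext; simp [T, mul_comm]) hT (D' := blockD V) (B' := blockB V)
    (Δ' := ∑ j ∈ Finset.range N, extendByZero z j • proj H j)
    (fun k x => by simp) (fun k x => by simp [mul_comm])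
    (fun k x => by
      simp only [_root_.sum_apply, Finset.sum_range]
      refine Finset.sum_congr rfl fun j _ => ?_
      simp [T, extendByZero, smul_smul, mul_comm]) 1
  have hval := hfz.eq_scalarTransfer hΔ
  have hξ' := eq_inverse_apply hu hξ
  rw [restrictVars, hval]
  have h1 : scalarTransfer V (∑ j ∈ Finset.range N, extendByZero z j • proj H j) 1 =
      blockA V 1 • 1 + blockB V ((∑ j ∈ Finset.range N, extendByZero z j • proj H j) ξ) := by
    rw [hξ']
    simp [scalarTransfer, transferOp]
  rw [h1]
  refine hsum.congr_fun fun α => ?_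
  rw [opMonomial_apply_of_eigenvector (ζ := z) fun j => by simp [T]]
  simp

/-! ### Operators on the Hilbert space tensor product -/

section Tensor

variable {K L M E : Type*} [NormedAddCommGroup E] [InnerProductSpace ℂ E]
  [NormedAddCommGroup K] [InnerProductSpace ℂ K] [NormedAddCommGroup L] [InnerProductSpace ℂ L]
  [NormedAddCommGroup M] [InnerProductSpace ℂ M]

variable (K E) in
/-- The bilinear map `(k, x) ↦ k ⊗ x` to the Hilbert space tensor product. -/
def tensorMk : K →L[ℂ] E →L[ℂ] HilbertTensor K E :=
  ContinuousLinearMap.compL ℂ E (K ⊗[ℂ] E) (HilbertTensor K E)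
    UniformSpace.Completion.toComplL ∘L TensorProduct.mkL ℂ K E

lemma tensorMk_apply (k : K) (x : E) :
    tensorMk K E k x = ((k ⊗ₜ[ℂ] x : K ⊗[ℂ] E) : HilbertTensor K E) := rfl

lemma tensorOp_mk (S : K →L[ℂ] L) (T : E →L[ℂ] E) (k : K) (x : E) :
    tensorOp S T (tensorMk K E k x) = tensorMk L E (S k) (T x) := by
  rw [tensorMk_apply, tensorOp, ContinuousLinearMap.completion_apply_coe]
  rfl

lemma tensor_induction {p : HilbertTensor K E → Prop} (hp : IsClosed {a | p a})
    (h0 : p 0) (hadd : ∀ a b, p a → p b → p (a + b)) (hmk : ∀ k x, p (tensorMk K E k x))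
    (a : HilbertTensor K E) : p a := by
  refine UniformSpace.Completion.induction_on a hp fun t => ?_
  induction t using TensorProduct.induction_on with
  | zero => rw [UniformSpace.Completion.coe_zero]; exact h0
  | tmul k x => exact hmk k x
  | add s t hs ht => rw [UniformSpace.Completion.coe_add]; exact hadd _ _ hs ht

lemma tensor_hom_ext {G : Type*} [NormedAddCommGroup G] [NormedSpace ℂ G]
    {S S' : HilbertTensor K E →L[ℂ] G}
    (h : ∀ k x, S (tensorMk K E k x) = S' (tensorMk K E k x)) : S = S' := by
  ext a
  refine tensor_induction (isClosed_eq S.continuous S'.continuous) (by simp) ?_ h a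
  intro a b ha hb
  rw [map_add, map_add, ha, hb]

lemma tensorOp_comp (S : L →L[ℂ] M) (S' : K →L[ℂ] L) (T T' : E →L[ℂ] E) :
    tensorOp S T ∘L tensorOp S' T' = tensorOp (S ∘L S') (T ∘L T') :=
  tensor_hom_ext fun k x => by simp [tensorOp_mk]

lemma tensorOp_tensorOp (S : L →L[ℂ] M) (S' : K →L[ℂ] L) (T T' : E →L[ℂ] E)
    (a : HilbertTensor K E) :
    tensorOp S T (tensorOp S' T' a) = tensorOp (S ∘L S') (T ∘L T') a := by
  rw [← tensorOp_comp]
  rfl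

lemma tensorOp_zero_left (T : E →L[ℂ] E) : tensorOp (0 : K →L[ℂ] L) T = 0 :=
  tensor_hom_ext fun k x => by simp [tensorOp_mk]

lemma tensorOp_id_one : tensorOp (ContinuousLinearMap.id ℂ K) (1 : E →L[ℂ] E) = 1 :=
  tensor_hom_ext fun k x => by simp [tensorOp_mk]

lemma tensorOp_add_left (S S' : K →L[ℂ] L) (T : E →L[ℂ] E) :
    tensorOp (S + S') T = tensorOp S T + tensorOp S' T :=
  tensor_hom_ext fun k x => by simp [tensorOp_mk]

lemma norm_tensorOp_le (S : K →L[ℂ] L) (T : E →L[ℂ] E) : ‖tensorOp S T‖ ≤ ‖S‖ * ‖T‖ := by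
  refine le_trans ?_ (TensorProduct.norm_mapL_le S T)
  refine ContinuousLinearMap.opNorm_le_bound _ (ContinuousLinearMap.opNorm_nonneg _) fun a => ?_
  refine UniformSpace.Completion.induction_on a
    (isClosed_le (by fun_prop) (by fun_prop)) fun t => ?_
  rw [tensorOp, ContinuousLinearMap.completion_apply_coe, UniformSpace.Completion.norm_coe,
    UniformSpace.Completion.norm_coe]
  exact (TensorProduct.mapL S T).le_opNorm t

lemma norm_tensorOp_one_le {S : K →L[ℂ] L} (hS : ‖S‖ ≤ 1) :
    ‖tensorOp S (1 : E →L[ℂ] E)‖ ≤ 1 :=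
  (norm_tensorOp_le S 1).trans
    (mul_le_one₀ hS (norm_nonneg _) ContinuousLinearMap.norm_id_le)

lemma inner_tensorMk (k l : K) (x y : E) :
    inner ℂ (tensorMk K E k x) (tensorMk K E l y) = inner ℂ k l * inner ℂ x y := by
  rw [tensorMk_apply, tensorMk_apply, UniformSpace.Completion.inner_coe,
    TensorProduct.inner_tmul]

/-- Formally adjoint operators stay so after tensoring with the identity. -/
lemma inner_tensorOp_one {S : K →L[ℂ] L} {S' : L →L[ℂ] K}
    (h : ∀ k l, inner ℂ (S k) l = inner ℂ k (S' l)) (a : HilbertTensor K E)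
    (b : HilbertTensor L E) :
    inner ℂ (tensorOp S (1 : E →L[ℂ] E) a) b = inner ℂ a (tensorOp S' (1 : E →L[ℂ] E) b) := by
  refine tensor_induction (p := fun a => inner ℂ (tensorOp S (1 : E →L[ℂ] E) a) b =
    inner ℂ a (tensorOp S' (1 : E →L[ℂ] E) b)) (isClosed_eq (by fun_prop) (by fun_prop))
    (by simp) ?_ ?_ a
  · intro a a' ha ha'
    rw [map_add, inner_add_left, inner_add_left, ha, ha']
  · intro k x
    refine tensor_induction (p := fun b => inner ℂ (tensorOp S (1 : E →L[ℂ] E) _) b =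
      inner ℂ _ (tensorOp S' (1 : E →L[ℂ] E) b)) (isClosed_eq (by fun_prop) (by fun_prop))
      (by simp) ?_ ?_ b
    · intro b b' hb hb'
      rw [map_add, inner_add_right, inner_add_right, hb, hb']
    · intro l y
      rw [tensorOp_mk, tensorOp_mk, inner_tensorMk, inner_tensorMk, h]
      rfl

lemma toScalarTensor_apply (x : E) : toScalarTensor x = tensorMk ℂ E 1 x := rfl

lemma norm_toScalarTensor (x : E) : ‖toScalarTensor x‖ = ‖x‖ := by
  rw [toScalarTensor_apply, tensorMk_apply, UniformSpace.Completion.norm_coe,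
    TensorProduct.norm_tmul, norm_one, one_mul]

variable [CompleteSpace E]

lemma ofScalarTensor_mk (a : ℂ) (x : E) : ofScalarTensor (tensorMk ℂ E a x) = a • x := by
  rw [tensorMk_apply, ofScalarTensor, ContinuousLinearMap.fromCompletion_apply_coe]
  simp

lemma norm_ofScalarTensor_apply_le (a : HilbertTensor ℂ E) : ‖ofScalarTensor a‖ ≤ ‖a‖ := by
  refine UniformSpace.Completion.induction_on a
    (isClosed_le (by fun_prop) (by fun_prop)) fun t => ?_
  rw [ofScalarTensor, ContinuousLinearMap.fromCompletion_apply_coe,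
    UniformSpace.Completion.norm_coe]
  exact ((TensorProduct.lidIsometry ℂ E).norm_map t).le

end Tensor

/-! ### Transfer functions of operator tuples -/

section OperatorTuples

variable {H : ℕ → Type*} [∀ j, NormedAddCommGroup (H j)] [∀ j, InnerProductSpace ℂ (H j)]
  {V : StateSpace H →L[ℂ] StateSpace H} {E : Type*} [NormedAddCommGroup E] [InnerProductSpace ℂ E]

lemma isBlockDiagonal_tensorOp_proj {T : ℕ → E →L[ℂ] E} {r : ℝ} (hT : ∀ j, ‖T j‖ ≤ r) :
    IsBlockDiagonal (fun j => tensorOp (proj H j) (1 : E →L[ℂ] E))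
      (fun j => tensorOp (proj H j) (T j)) r where
  symm j := inner_tensorOp_one (inner_proj j)
  idem j a := by
    rw [tensorOp_tensorOp]
    congr 2
    ext1 k
    simp [proj_proj]
  orth i j hij a := by
    rw [tensorOp_tensorOp]
    have : proj H i ∘L proj H j = 0 := by ext1 k; simp [proj_proj, hij]
    rw [this, tensorOp_zero_left, _root_.zero_apply]
  right j a := by
    rw [tensorOp_tensorOp]
    congr 2
    ext1 k
    simp [proj_proj]
  left j a := by
    rw [tensorOp_tensorOp]
    congr 2
    ext1 k
    simp [proj_proj]
  norm_le j := (norm_tensorOp_le _ _).trans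
    ((mul_le_of_le_one_left (norm_nonneg _) (norm_proj_le j)).trans (hT j))

lemma inner_inclScalar (x : ℂ) (s : StateSpace H) :
    inner ℂ (inclScalar x) s = inner ℂ x (WithLp.fstL 2 ℂ ℂ (HilbertSum H) s) := by
  simp [inclScalar, WithLp.prod_inner_apply]

lemma inner_inclSum (k : HilbertSum H) (s : StateSpace H) :
    inner ℂ (inclSum k) s = inner ℂ k (WithLp.sndL 2 ℂ ℂ (HilbertSum H) s) := by
  simp [inclSum, WithLp.prod_inner_apply]

/-- A splitting of the Hilbert space `S` as an orthogonal sum of `K` and `L` persists after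
tensoring. -/
lemma norm_sq_tensor_of_splitting {S K L : Type*} [NormedAddCommGroup S] [InnerProductSpace ℂ S]
    [NormedAddCommGroup K] [InnerProductSpace ℂ K] [NormedAddCommGroup L] [InnerProductSpace ℂ L]
    {f : S →L[ℂ] K} {g : S →L[ℂ] L} {i : K →L[ℂ] S} {j : L →L[ℂ] S}
    (hi : ∀ k s, inner ℂ (i k) s = inner ℂ k (f s))
    (hj : ∀ l s, inner ℂ (j l) s = inner ℂ l (g s))
    (hfg : i ∘L f + j ∘L g = ContinuousLinearMap.id ℂ S) (s : HilbertTensor S E) :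
    ‖s‖ ^ 2 = ‖tensorOp f (1 : E →L[ℂ] E) s‖ ^ 2 + ‖tensorOp g (1 : E →L[ℂ] E) s‖ ^ 2 := by
  set p := tensorOp f (1 : E →L[ℂ] E) s with hp
  set q := tensorOp g (1 : E →L[ℂ] E) s with hq
  have hs : tensorOp i (1 : E →L[ℂ] E) p + tensorOp j (1 : E →L[ℂ] E) q = s := by
    have h1 : (1 : E →L[ℂ] E) ∘L 1 = 1 := rfl
    rw [hp, hq, tensorOp_tensorOp, tensorOp_tensorOp, ← _root_.add_apply, h1, ← tensorOp_add_left,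
      hfg, tensorOp_id_one]
    rfl
  have h : inner ℂ s s = inner ℂ p p + inner ℂ q q := by
    nth_rw 1 [← hs]
    rw [inner_add_left, inner_tensorOp_one hi, inner_tensorOp_one hj]
  simp only [inner_self_eq_norm_sq_to_K] at h
  exact_mod_cast h

lemma norm_sq_tensor_stateSpace (s : HilbertTensor (StateSpace H) E) :
    ‖s‖ ^ 2 = ‖tensorOp (WithLp.fstL 2 ℂ ℂ (HilbertSum H)) (1 : E →L[ℂ] E) s‖ ^ 2 +
      ‖tensorOp (WithLp.sndL 2 ℂ ℂ (HilbertSum H)) (1 : E →L[ℂ] E) s‖ ^ 2 := by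
  refine norm_sq_tensor_of_splitting inner_inclScalar inner_inclSum ?_ s
  ext1 s
  simp only [inclScalar, inclSum, _root_.add_apply, ContinuousLinearMap.comp_apply]
  change WithLp.toLp 2 (WithLp.fst s, (0 : HilbertSum H)) +
    WithLp.toLp 2 ((0 : ℂ), WithLp.snd s) = s
  rw [← WithLp.toLp_add]
  simp
  rfl

/-- The blocks of `V ⊗ I` form a contraction of `(ℂ ⊗ E) ⊕ ((⨁ H_j) ⊗ E)`, because this space is
`(ℂ ⊕ ⨁ H_j) ⊗ E`. -/
lemma tensor_block_norm_sq_le (hV : ‖V‖ ≤ 1) (a : HilbertTensor ℂ E)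
    (ξ : HilbertTensor (HilbertSum H) E) :
    ‖tensorOp (blockA V) (1 : E →L[ℂ] E) a + tensorOp (blockB V) (1 : E →L[ℂ] E) ξ‖ ^ 2 +
      ‖tensorOp (blockC V) (1 : E →L[ℂ] E) a + tensorOp (blockD V) (1 : E →L[ℂ] E) ξ‖ ^ 2 ≤
    ‖a‖ ^ 2 + ‖ξ‖ ^ 2 := by
  have h1 : (1 : E →L[ℂ] E) ∘L 1 = 1 := rfl
  set s := tensorOp inclScalar (1 : E →L[ℂ] E) a + tensorOp inclSum (1 : E →L[ℂ] E) ξ with hs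
  have hf : tensorOp (WithLp.fstL 2 ℂ ℂ (HilbertSum H)) (1 : E →L[ℂ] E) s = a := by
    rw [hs, map_add, tensorOp_tensorOp, tensorOp_tensorOp, h1]
    have e1 : WithLp.fstL 2 ℂ ℂ (HilbertSum H) ∘L inclScalar = ContinuousLinearMap.id ℂ ℂ := by
      ext; simp [inclScalar]
    have e2 : WithLp.fstL 2 ℂ ℂ (HilbertSum H) ∘L inclSum = 0 := by
      ext1; simp [inclSum]
    rw [e1, e2, tensorOp_zero_left, tensorOp_id_one]
    simp
  have hg : tensorOp (WithLp.sndL 2 ℂ ℂ (HilbertSum H)) (1 : E →L[ℂ] E) s = ξ := by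
    rw [hs, map_add, tensorOp_tensorOp, tensorOp_tensorOp, h1]
    have e1 : WithLp.sndL 2 ℂ ℂ (HilbertSum H) ∘L inclScalar = 0 := by
      ext1; simp [inclScalar]
    have e2 : WithLp.sndL 2 ℂ ℂ (HilbertSum H) ∘L inclSum =
        ContinuousLinearMap.id ℂ (HilbertSum H) := by
      ext1; simp [inclSum]
    rw [e1, e2, tensorOp_zero_left, tensorOp_id_one]
    simp
  have hn : ‖s‖ ^ 2 = ‖a‖ ^ 2 + ‖ξ‖ ^ 2 := by rw [norm_sq_tensor_stateSpace, hf, hg]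
  have hle : ‖tensorOp V (1 : E →L[ℂ] E) s‖ ≤ ‖s‖ := by
    simpa using (tensorOp V (1 : E →L[ℂ] E)).le_of_opNorm_le (norm_tensorOp_one_le hV) s
  have hsq := pow_le_pow_left₀ (norm_nonneg _) hle 2
  rw [norm_sq_tensor_stateSpace, hn] at hsq
  simp only [hs, map_add, tensorOp_tensorOp, h1] at hsq
  exact hsq

/-- The transfer operator of the tuple `T`, for a given block diagonal operator `Δ`. -/
def tensorTransfer [CompleteSpace E] (V : StateSpace H →L[ℂ] StateSpace H)
    (Δ : HilbertTensor (HilbertSum H) E →L[ℂ] HilbertTensor (HilbertSum H) E) : E →L[ℂ] E :=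
  ofScalarTensor ∘L
    transferOp (tensorOp (blockA V) 1) (tensorOp (blockB V) 1) (tensorOp (blockC V) 1)
      (tensorOp (blockD V) 1) Δ ∘L toScalarTensor

variable [CompleteSpace E]

lemma norm_tensorTransfer_le (hV : ‖V‖ ≤ 1)
    {Δ : HilbertTensor (HilbertSum H) E →L[ℂ] HilbertTensor (HilbertSum H) E} {r : ℝ}
    (hΔ : ‖Δ‖ ≤ r) (hr : r < 1) : ‖tensorTransfer V Δ‖ ≤ 1 := by
  refine ContinuousLinearMap.opNorm_le_bound _ zero_le_one fun x => ?_
  rw [one_mul]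
  refine (norm_ofScalarTensor_apply_le _).trans ?_
  have h := norm_transferOp_le (tensor_block_norm_sq_le (E := E) hV) (hΔ.trans hr.le)
    (isUnit_one_sub_comp (norm_tensorOp_one_le (norm_blockD_le hV)) hΔ hr)
  refine (ContinuousLinearMap.le_of_opNorm_le _ h _).trans_eq ?_
  rw [one_mul]
  exact norm_toScalarTensor x

/-- The power series of the transfer function of `V` at a commuting tuple is given by the transfer
operator with the corresponding finite sum `∑ P_j ⊗ T_j`. -/
lemma hasSum_tensorTransfer [∀ j, CompleteSpace (H j)] (hV : ‖V‖ ≤ 1) {T : ℕ → E →L[ℂ] E}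
    (hT : ∀ i j, Commute (T i) (T j)) {r : ℝ} (hr : r < 1) (hTr : ∀ j, ‖T j‖ ≤ r) (N : ℕ) (x : E) :
    HasSum (fun α : Fin N → ℕ => transferCoeff (blockA V 1) (blockB V) (blockD V) (blockC V 1) α •
      opMonomial (fun j : Fin N => T j) α x)
      (tensorTransfer V (∑ j ∈ Finset.range N, tensorOp (proj H j) (T j)) x) := by
  obtain ⟨ξ, hξ, hsum⟩ := exists_state_vector (norm_blockD_le hV) (norm_blockC_one_le hV)
    (blockB V) (blockA V 1) (tensorMk (HilbertSum H) E) (T := fun j : Fin N => T j)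
    (fun i j => hT i j) (fun j => (hTr j).trans_lt hr) (D' := tensorOp (blockD V) 1)
    (B' := ofScalarTensor ∘L tensorOp (blockB V) 1)
    (Δ' := ∑ j ∈ Finset.range N, tensorOp (proj H j) (T j))
    (fun k y => by rw [tensorOp_mk]; rfl)
    (fun k y => by rw [ContinuousLinearMap.comp_apply, tensorOp_mk, ofScalarTensor_mk]; rfl)
    (fun k y => by
      simp only [_root_.sum_apply, Finset.sum_range]
      exact Finset.sum_congr rfl fun j _ => tensorOp_mk _ _ _ _) x
  have hu : IsUnit (1 - tensorOp (blockD V) (1 : E →L[ℂ] E) ∘L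
      ∑ j ∈ Finset.range N, tensorOp (proj H j) (T j)) :=
    isUnit_one_sub_comp (norm_tensorOp_one_le (norm_blockD_le hV))
      ((isBlockDiagonal_tensorOp_proj hTr).norm_sum_range_le N) hr
  have hval : tensorTransfer V (∑ j ∈ Finset.range N, tensorOp (proj H j) (T j)) x =
      blockA V 1 • x + (ofScalarTensor ∘L tensorOp (blockB V) 1)
        ((∑ j ∈ Finset.range N, tensorOp (proj H j) (T j)) ξ) := by
    have hC : tensorOp (blockC V) (1 : E →L[ℂ] E) (toScalarTensor x) =
        tensorMk (HilbertSum H) E (blockC V 1) x := by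
      rw [toScalarTensor_apply, tensorOp_mk]
      rfl
    have hA : ofScalarTensor (tensorOp (blockA V) (1 : E →L[ℂ] E) (toScalarTensor x)) =
        blockA V 1 • x := by
      rw [toScalarTensor_apply, tensorOp_mk, ofScalarTensor_mk]
      rfl
    rw [eq_inverse_apply hu hξ, ← hC, ← hA]
    exact map_add ofScalarTensor _ _
  rw [hval]
  exact hsum

/-- The functional calculus and von Neumann's inequality for the transfer function of a
contraction. -/
lemma exists_isTransferOperator [∀ j, CompleteSpace (H j)] (hV : ‖V‖ ≤ 1) {f : (ℕ → ℂ) → ℂ}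
    (hf : ∀ z ∈ ballC00, IsTransferValue V z (f z)) {T : ℕ → E →L[ℂ] E}
    (hT : ∀ i j, Commute (T i) (T j)) (hTr : ∃ r : ℝ, r < 1 ∧ ∀ j, ‖T j‖ ≤ r) :
    ∃ (fT : E →L[ℂ] E) (fNT : ℕ → E →L[ℂ] E),
      IsTransferOperator V T fT ∧
      (∀ N, IsPowerSeriesCalc (restrictVars f N) (fun j : Fin N => T j) (fNT N)) ∧
      (∀ x : E, Tendsto (fun N => fNT N x) atTop (𝓝 (fT x))) ∧ ‖fT‖ ≤ 1 := by
  obtain ⟨r, hr, hTr⟩ := hTr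
  have hb := isBlockDiagonal_tensorOp_proj (H := H) hTr
  obtain ⟨Δ, hΔ, hn⟩ := hb.exists_isStrongSum
  have hD : ‖tensorOp (blockD V) (1 : E →L[ℂ] E)‖ ≤ 1 :=
    norm_tensorOp_one_le (norm_blockD_le hV)
  refine ⟨tensorTransfer V Δ, fun N => tensorTransfer V
    (∑ j ∈ Finset.range N, tensorOp (proj H j) (T j)),
    ⟨Δ, hΔ, isUnit_one_sub_comp hD hn hr, rfl⟩, fun N => ?_, fun x => ?_,
    norm_tensorTransfer_le hV hn hr⟩
  · have hc := isPowerSeriesOf_transferCoeff hV hf N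
    have hs := hc.summable_norm_smul_opMonomial (T := fun j : Fin N => T j)
      fun j => (hTr j).trans_lt hr
    refine ⟨_, hc, hs, ?_⟩
    have h1 := hs.of_norm.hasSum
    have h2 : tensorTransfer V (∑ j ∈ Finset.range N, tensorOp (proj H j) (T j)) = _ :=
      ContinuousLinearMap.ext fun x => (hasSum_tensorTransfer hV hT hr hTr N x).unique
        (h1.mapL (ContinuousLinearMap.apply ℂ E x))
    change HasSum _ (tensorTransfer V (∑ j ∈ Finset.range N, tensorOp (proj H j) (T j)))
    rw [h2]
    exact h1
  · exact (ofScalarTensor.continuous.tendsto _).comp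
      (tendsto_transferOp_apply hD hr hb.norm_sum_range_le hn hΔ.tendsto (toScalarTensor x))

end OperatorTuples

end SchurAgler

end

theorem theorem1p2 :
    (∀ f : (ℕ → ℂ) → ℂ, SchurAgler.AglerClassInfty f →
      ∃ (H : ℕ → Type) (_ : ∀ j, NormedAddCommGroup (H j))
        (_ : ∀ j, InnerProductSpace ℂ (H j)) (_ : ∀ j, CompleteSpace (H j))
        (V : SchurAgler.StateSpace H →L[ℂ] SchurAgler.StateSpace H) (F : (ℕ → ℂ) → ℂ),
        -- the transfer function `F` of a contraction `V` extends `f` to the ball of `ℓ^∞`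
        ‖V‖ ≤ 1 ∧
        (∀ z ∈ SchurAgler.ballLinfty, SchurAgler.IsTransferValue V z (F z)) ∧
        (∀ z ∈ SchurAgler.ballC00, F z = f z) ∧
        (∀ z ∈ SchurAgler.ballLinfty, ‖F z‖ ≤ 1) ∧
        DifferentiableOn ℂ (fun z : lp (fun _ : ℕ => ℂ) ∞ => F z) (Metric.ball 0 1) ∧
        (∀ z ∈ SchurAgler.ballLinfty,
          Tendsto (fun N => f (SchurAgler.truncate N z)) atTop (𝓝 (F z))) ∧
        -- Agler decomposition on the ball of `ℓ^∞`
        SchurAgler.HasAglerDecomposition SchurAgler.ballLinfty F ∧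
        -- functional calculus and von Neumann inequality
        (∀ (E : Type u) [NormedAddCommGroup E] [InnerProductSpace ℂ E] [CompleteSpace E]
          (T : ℕ → E →L[ℂ] E), (∀ i j, Commute (T i) (T j)) →
          (∃ r : ℝ, r < 1 ∧ ∀ j, ‖T j‖ ≤ r) →
          ∃ (fT : E →L[ℂ] E) (fNT : ℕ → E →L[ℂ] E),
            SchurAgler.IsTransferOperator V T fT ∧
            (∀ N, SchurAgler.IsPowerSeriesCalc (SchurAgler.restrictVars f N)
              (fun j : Fin N => T j) (fNT N)) ∧
            (∀ x : E, Tendsto (fun N => fNT N x) atTop (𝓝 (fT x))) ∧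
            ‖fT‖ ≤ 1)) ∧
    -- transfer function realizations and Agler decompositions are equivalent
    (∀ X : Set (ℕ → ℂ), X ⊆ SchurAgler.ballLinfty → ∀ g : (ℕ → ℂ) → ℂ,
      SchurAgler.HasTransferRealization X g ↔ SchurAgler.HasAglerDecomposition X g) := by
  refine ⟨fun f hf => ?_, fun X hX g => ⟨fun h => h.hasAglerDecomposition hX,
    fun h => h.hasTransferRealization hX⟩⟩
  have h00 : SchurAgler.ballC00 ⊆ SchurAgler.ballLinfty := fun z hz => hz.1
  obtain ⟨H, _, _, _, V, hV, hVf⟩ := hf.hasAglerDecomposition.hasTransferRealization h00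
  choose! F hF using fun z (hz : z ∈ SchurAgler.ballLinfty) =>
    SchurAgler.exists_isTransferValue hV hz
  have hFf : ∀ z ∈ SchurAgler.ballC00, F z = f z := fun z hz =>
    (hF z (h00 hz)).unique (hVf z hz)
  refine ⟨H, inferInstance, inferInstance, inferInstance, V, F, hV, hF, hFf,
    fun z hz => (hF z hz).norm_le hV hz, SchurAgler.differentiableOn_transferValue hV hF,
    fun z hz => ?_, ?_, fun E _ _ _ T hT hTr => SchurAgler.exists_isTransferOperator hV hVf hT hTr⟩
  · refine (SchurAgler.tendsto_transferValue_truncate hV hF hz).congr fun N => ?_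
    exact hFf _ (SchurAgler.truncate_mem_ballC00 hz N)
  · have h : SchurAgler.HasTransferRealization SchurAgler.ballLinfty F :=
      ⟨H, inferInstance, inferInstance, inferInstance, V, hV, hF⟩
    exact h.hasAglerDecomposition subset_rfl
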